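/- **Hamiltonian simulation.** For $t'>0$ and $0<\varepsilon'<1$ let $r(t',\varepsilon')$ be the unique solution $r\in(t',\infty)$ of $\varepsilon'=(t'/r)^r$; for $\varepsilon'\ge 1$, where there is no solution, put $r(t',\varepsilon'):=t'$ (the limit as $\varepsilon'\to 1$). Let $\mathcal H$ be a finite-dimensional Hilbert space and $m\ge 0$. A unitary $U_H$ on $(\mathbb C^2)^{\otimes m}\otimes\mathcal H$ is a block-encoding of a matrix $H\in\mathcal L(\mathcal H)$ if $(\langle 0^m|\otimes I)\,U_H\,(|0^m\rangle\otimes I)=H$. A circuit with queries acts on a finite number of qubits and on $\mathcal H$; it is a finite sequence of fixed unitary gates, which do not depend on $U_H$, and of queries, each of which applies controlled-$U_H$ or controlled-$U_H^\dagger$. It implements the quantum channel on $\mathcal L(\mathcal H)$ obtained by initializing all qubits in $|0\rangle$, running the circuit, and tracing out the qubits. The diamond norm of a linear map $\Lambda$ on $\mathcal L(\mathcal H)$ is $|\Lambda|_\diamond=\sup_\rho|(\Lambda\otimes\mathcal I)(\rho)|_1$, where $|\cdot|_1$ is the trace norm, $\mathcal I$ is the identity on $\mathcal L(\mathbb C^k)$,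 and the supremum is over all $k$ and all density matrices $\rho$ on $\mathcal H\otimes\mathbb C^k$. Then for all $t>0$ and $\varepsilon>0$ there is a circuit with at most $$3\cdot r\!\left(\frac{et}{2},\frac{\varepsilon}{24}\right)+3$$ queries to controlled-$U_H$ or controlled-$U_H^\dagger$ such that, for every Hermitian matrix $H$ on $\mathcal H$ and every block-encoding $U_H$ of $H$ with $m$ ancilla qubits, the map $\Lambda$ it implements is a quantum channel (completely positive and trace preserving) and is $\varepsilon$-close in diamond norm to the channel $\rho\mapsto e^{iHt}\rho\, e^{-iHt}$: $$\left|\Lambda-\left(\rho\mapsto e^{iHt}\rho\, e^{-iHt}\right)\right|_\diamond\le\varepsilon .$$ -/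

import Mathlib

open scoped Matrix Kronecker ENNReal ComplexOrder

noncomputable section

namespace HamSim

/-! ### The function `r(t', ε')` -/

/-- For `t' > 0` and `0 < ε' < 1` the equation `(t' / r) ^ r = ε'` has exactly one
solution `r` in `(t', ∞)`. -/
theorem existsUnique_rate {t' ε' : ℝ} (h : 0 < t' ∧ 0 < ε' ∧ ε' < 1) :
    ∃! r : ℝ, t' < r ∧ (t' / r) ^ r = ε' := by
  obtain ⟨ht, he, he1⟩ := h
  have hpow : ∀ r : ℝ, t' ≤ r → (t' / r) ^ r = Real.exp (r * (Real.log t' - Real.log r)) := by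
    intro r hr
    have hr0 : 0 < r := ht.trans_le hr
    rw [Real.rpow_def_of_pos (div_pos ht hr0), Real.log_div ht.ne' hr0.ne', mul_comm]
  have hanti : StrictAntiOn (fun r : ℝ => r * (Real.log t' - Real.log r)) (Set.Ici t') := by
    intro a ha b hb hab
    have ha0 : 0 < a := ht.trans_le ha
    have hb0 : 0 < b := ha0.trans hab
    have h1 : Real.log a < Real.log b := Real.log_lt_log ha0 hab
    have h2 : Real.log t' ≤ Real.log a := Real.log_le_log ht ha
    change b * (Real.log t' - Real.log b) < a * (Real.log t' - Real.log a)
    nlinarith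
  have hcont : ContinuousOn (fun r : ℝ => r * (Real.log t' - Real.log r)) (Set.Ici t') := by
    refine continuousOn_id.mul (continuousOn_const.sub (Real.continuousOn_log.mono ?_))
    intro x hx
    exact (ht.trans_le hx).ne'
  have hlog : Real.log ε' < 0 := Real.log_neg he he1
  set M : ℝ := t' * Real.exp 1 - Real.log ε' with hM
  have hexp : 1 < Real.exp 1 := by simp
  have hte : t' < t' * Real.exp 1 := lt_mul_of_one_lt_right ht hexp
  have hM1 : t' * Real.exp 1 ≤ M := by linarith
  have htM : t' ≤ M := by linarith
  have hfM : M * (Real.log t' - Real.log M) ≤ Real.log ε' := by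
    have h1 : Real.log (t' * Real.exp 1) ≤ Real.log M :=
      Real.log_le_log (by positivity) hM1
    rw [Real.log_mul ht.ne' (Real.exp_pos 1).ne', Real.log_exp] at h1
    have h2 : -Real.log ε' ≤ M := by linarith
    nlinarith
  have hmem : Real.log ε' ∈ Set.Icc (M * (Real.log t' - Real.log M))
      (t' * (Real.log t' - Real.log t')) := ⟨hfM, by simpa using hlog.le⟩
  obtain ⟨r, hr, hrv⟩ := intermediate_value_Icc' htM (hcont.mono Set.Icc_subset_Ici_self) hmem
  have hrv' : r * (Real.log t' - Real.log r) = Real.log ε' := hrv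
  have hrt : t' < r := by
    rcases hr.1.eq_or_lt with h | h
    · rw [← h] at hrv'
      simp at hrv'
      linarith
    · exact h
  refine ⟨r, ⟨hrt, by rw [hpow r hrt.le, hrv', Real.exp_log he]⟩, ?_⟩
  rintro s ⟨hs, hsv⟩
  rw [hpow s hs.le] at hsv
  refine hanti.injOn (Set.mem_Ici.2 hs.le) (Set.mem_Ici.2 hrt.le) ?_
  rw [hrv', ← hsv, Real.log_exp]

open Classical in
/-- `rate t' ε'` is the solution `r ∈ (t', ∞)` of `ε' = (t' / r) ^ r`, for `t' > 0` and
`0 < ε' < 1`.  For `ε' ≥ 1`, where there is no solution, it is the limiting value `t'`. -/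
def rate (t' ε' : ℝ) : ℝ :=
  if h : 0 < t' ∧ 0 < ε' ∧ ε' < 1 then (existsUnique_rate h).choose else t'

theorem rate_spec {t' ε' : ℝ} (ht : 0 < t') (h0 : 0 < ε') (h1 : ε' < 1) :
    t' < rate t' ε' ∧ (t' / rate t' ε') ^ rate t' ε' = ε' := by
  have h : 0 < t' ∧ 0 < ε' ∧ ε' < 1 := ⟨ht, h0, h1⟩
  rw [rate, dif_pos h]
  exact (existsUnique_rate h).choose_spec.1

/-! ### Maps on matrices, channels, the diamond norm -/

section Channels

variable {ι : Type*} [Fintype ι] [DecidableEq ι]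

/-- The map `ρ ↦ K ρ K†`. -/
def conjMap (K : Matrix ι ι ℂ) : Matrix ι ι ℂ →ₗ[ℂ] Matrix ι ι ℂ :=
  LinearMap.mulLeft ℂ K ∘ₗ LinearMap.mulRight ℂ Kᴴ

/-- The value `(Φ ⊗ 𝓘)(X)`, where `𝓘` is the identity on the matrices indexed by `κ`:
`Φ` is applied to every `κ`-block of `X`. -/
def ampliate (Φ : Matrix ι ι ℂ →ₗ[ℂ] Matrix ι ι ℂ) {κ : Type*}
    (X : Matrix (ι × κ) (ι × κ) ℂ) : Matrix (ι × κ) (ι × κ) ℂ :=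
  Matrix.of fun p q => Φ (Matrix.of fun i j => X (i, p.2) (j, q.2)) p.1 q.1

/-- The trace norm: the sum of the singular values, which are the square roots of the
eigenvalues of `M† M`. -/
def traceNorm (M : Matrix ι ι ℂ) : ℝ :=
  ∑ i, Real.sqrt ((Matrix.isHermitian_conjTranspose_mul_self M).eigenvalues i)

/-- Density matrices. -/
def IsDensity (ρ : Matrix ι ι ℂ) : Prop :=
  ρ.PosSemidef ∧ ρ.trace = 1

/-- The diamond norm `sup_ρ ‖(Φ ⊗ 𝓘)(ρ)‖₁`, where `ρ` runs through the density matrices on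
the space of `Φ` tensored with a reference space of arbitrary finite dimension `k`. -/
def diamondNorm (Φ : Matrix ι ι ℂ →ₗ[ℂ] Matrix ι ι ℂ) : ℝ≥0∞ :=
  ⨆ (k : ℕ) (ρ : Matrix (ι × Fin k) (ι × Fin k) ℂ) (_ : IsDensity ρ),
    ENNReal.ofReal (traceNorm (ampliate Φ ρ))

/-- Quantum channels: completely positive, trace-preserving maps. -/
def IsChannel (Φ : Matrix ι ι ℂ →ₗ[ℂ] Matrix ι ι ℂ) : Prop :=
  (∀ (k : ℕ) (X : Matrix (ι × Fin k) (ι × Fin k) ℂ), X.PosSemidef → (ampliate Φ X).PosSemidef) ∧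
    ∀ X : Matrix ι ι ℂ, (Φ X).trace = X.trace

/-! ### Block-encodings and circuits with queries -/

/-- The computational basis of `n` qubits; the state `|0ⁿ⟩` is the basis vector `0`. -/
abbrev Qubits (n : ℕ) : Type := Fin n → Fin 2

/-- `U` is a unitary on `m` qubits and `ℋ = ℂ^ι` with `(⟨0ᵐ| ⊗ I) U (|0ᵐ⟩ ⊗ I) = A`. -/
structure IsBlockEncoding {m : ℕ} (U : Matrix (Qubits m × ι) (Qubits m × ι) ℂ)
    (A : Matrix ι ι ℂ) : Prop where
  unitary : U ∈ Matrix.unitaryGroup (Qubits m × ι) ℂ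
  block : ∀ i j, U (0, i) (0, j) = A i j

/-- The registers of a circuit: the control qubit of the queries, `w` work qubits, and the
`m` qubits and the system `ℂ^ι` on which the queried unitary acts. -/
abbrev Register (w m : ℕ) (ι : Type*) : Type _ :=
  Fin 2 × (Qubits w × (Qubits m × ι))

/-- `|0⟩⟨0| ⊗ I ⊗ I + |1⟩⟨1| ⊗ I ⊗ U`. -/
def controlled {m : ℕ} (w : ℕ) (U : Matrix (Qubits m × ι) (Qubits m × ι) ℂ) :
    Matrix (Register w m ι) (Register w m ι) ℂ :=
  Matrix.single (0 : Fin 2) (0 : Fin 2) (1 : ℂ) ⊗ₖ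
      ((1 : Matrix (Qubits w) (Qubits w) ℂ) ⊗ₖ (1 : Matrix (Qubits m × ι) (Qubits m × ι) ℂ)) +
    Matrix.single (1 : Fin 2) (1 : Fin 2) (1 : ℂ) ⊗ₖ
      ((1 : Matrix (Qubits w) (Qubits w) ℂ) ⊗ₖ U)

/-- A step of a circuit: a fixed unitary gate, or a query to the controlled unitary or to its
controlled inverse.  The gates do not depend on the queried unitary, and a gate may permute the
registers, so that a query can be made on any qubits. -/
inductive Step (w m : ℕ) (ι : Type*) [Fintype ι] [DecidableEq ι]
  | gate (V : Matrix.unitaryGroup (Register w m ι) ℂ) : Step w m ι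
  | query : Step w m ι
  | queryInv : Step w m ι

/-- The unitary performed by a step when the queried unitary is `U`. -/
def Step.eval {w m : ℕ} (U : Matrix (Qubits m × ι) (Qubits m × ι) ℂ) :
    Step w m ι → Matrix (Register w m ι) (Register w m ι) ℂ
  | .gate V => V.1
  | .query => controlled w U
  | .queryInv => controlled w Uᴴ

/-- The number of queries in a step. -/
def Step.queries {w m : ℕ} : Step w m ι → ℕ
  | .gate _ => 0
  | .query => 1
  | .queryInv => 1

/-- A circuit with queries is a list of steps; the head of the list is performed last. -/
abbrev Circuit (w m : ℕ) (ι : Type*) [Fintype ι] [DecidableEq ι] : Type _ :=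
  List (Step w m ι)

/-- The unitary performed by a circuit when the queried unitary is `U`. -/
def Circuit.eval {w m : ℕ} (C : Circuit w m ι) (U : Matrix (Qubits m × ι) (Qubits m × ι) ℂ) :
    Matrix (Register w m ι) (Register w m ι) ℂ :=
  (C.map (Step.eval U)).prod

/-- The number of queries made by a circuit. -/
def Circuit.queries {w m : ℕ} (C : Circuit w m ι) : ℕ :=
  (C.map Step.queries).sum

/-- The channel implemented by a circuit `W`: all qubits are initialized to `|0⟩`, `W` is
applied, and the qubits are traced out,
`ρ ↦ ∑ x, (⟨x| ⊗ I) W (|0⟩⟨0| ⊗ ρ) W† (|x⟩ ⊗ I)`. -/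
def Circuit.channel {w m : ℕ} (C : Circuit w m ι)
    (U : Matrix (Qubits m × ι) (Qubits m × ι) ℂ) : Matrix ι ι ℂ →ₗ[ℂ] Matrix ι ι ℂ :=
  ∑ x : Fin 2 × Qubits w × Qubits m,
    conjMap (Matrix.of fun i j => C.eval U (x.1, x.2.1, x.2.2, i) (0, 0, 0, j))

end Channels

end HamSim

end

set_option linter.unusedSectionVars false

/-! The circuit realises a polynomial of `H` close to `exp (i t H)`, by quantum signal processing
without any spectral analysis of `U`.

Approximation: `cos (t x)` and `i sin (t x)` are interpolated at Chebyshev nodes by polynomials of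
definite parity and degree at most `N`, where `N` is at least the rate `r`. The interpolation error
is below `ε / 32`, so after shrinking both polynomials below `1` on `[-1, 1]` their sum is `ε /
8`-close to the exponential (`exists_polynomials_near_exp`).

Signal processing: for `F` of the parity of `n`, write `F ((z + 1/z) / 2) = z ^ (-n) * P (z ^ 2)`
(`aeval_laurentForm`). Since `|P| < 1` on the unit circle, a Fejér–Riesz argument completes `P` to a
pair `(P, Q)` of unit length on the circle. Peeling off one degree at a time turns the pair into an
alternating product of fixed `2 × 2` unitaries and signals (`exists_qspColumn_apply_zero_eq`).

Block-encoding: let `r` also denote the reflection about `|0ᵐ⟩`. On a doubled space, `U` and its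
adjoint form an involution `ũ`, and `r ũ` is a walk operator with inverse `ũ r`. The projection `J`
onto `|0ᵐ⟩` intertwines the mean of the walk and its inverse with `H`, up to a flip of the doubling
index. Hence `J` carries every polynomial of that mean to the same polynomial of `H`
(`mul_qspColumn_signal`). The doubling index after `n` steps is the parity of `n`, so the circuit
only has to alternate `U` and its adjoint.

Assembly: a superposed qubit runs both polynomials with the same `n + 1` queries and yields half
their sum (`exists_circuit_block`). Oblivious amplitude amplification maps the block `B` to `3 B - 4
B B† B`, which removes the factor `1/2` and triples the queries (`exists_circuit_amplified`). It at
most doubles the error, to `ε / 4`. A channel with a Kraus operator `δ`-close to a unitary is `4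
δ`-close to the unitary channel (`diamondNorm_sub_le`), which gives `ε`. -/

namespace HamSim

/-! ### Fejér–Riesz factorisation and complementary polynomials -/

open Polynomial

/-- The polynomial `X ^ n * conj (f (1 / conj X))`. -/
noncomputable def conjReflect (n : ℕ) (f : ℂ[X]) : ℂ[X] :=
  (f.map (starRingEnd ℂ)).reflect n

theorem conjReflect_mul {f g : ℂ[X]} {m n : ℕ} (hf : f.natDegree ≤ m) (hg : g.natDegree ≤ n) :
    conjReflect (m + n) (f * g) = conjReflect m f * conjReflect n g := by
  unfold conjReflect
  rw [Polynomial.map_mul, reflect_mul] <;> simpa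

theorem conjReflect_add (n : ℕ) (f g : ℂ[X]) :
    conjReflect n (f + g) = conjReflect n f + conjReflect n g := by
  simp [conjReflect, reflect_add]

theorem conjReflect_C_mul (n : ℕ) (a : ℂ) (f : ℂ[X]) :
    conjReflect n (C a * f) = C (star a) * conjReflect n f := by
  simp [conjReflect, reflect_C_mul]

theorem conjReflect_succ {f : ℂ[X]} {n : ℕ} (hf : f.natDegree ≤ n) :
    conjReflect (n + 1) f = X * conjReflect n f := by
  have := conjReflect_mul (f := f) (g := 1) (m := n) (n := 1) hf (by simp)
  rw [mul_one] at this
  rw [this, mul_comm]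
  simp [conjReflect]

theorem conjReflect_X_mul {f : ℂ[X]} {n : ℕ} (hf : f.natDegree ≤ n) :
    conjReflect (n + 1) (X * f) = conjReflect n f := by
  rw [mul_comm X f, conjReflect_mul hf natDegree_X_le]
  simp [conjReflect]

theorem coeff_conjReflect {n k : ℕ} (hk : k ≤ n) (f : ℂ[X]) :
    (conjReflect n f).coeff k = star (f.coeff (n - k)) := by
  simp [conjReflect, coeff_reflect, revAt_le hk]

theorem natDegree_conjReflect_le {n : ℕ} {f : ℂ[X]} (hf : f.natDegree ≤ n) :
    (conjReflect n f).natDegree ≤ n := by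
  unfold conjReflect
  refine natDegree_reflect_le.trans ?_
  simpa using hf

theorem conjReflect_conjReflect (n : ℕ) (f : ℂ[X]) : conjReflect n (conjReflect n f) = f := by
  unfold conjReflect
  rw [← reflect_map, reflect_reflect, Polynomial.map_map]
  convert Polynomial.map_id
  ext; simp

theorem eval_conjReflect {n : ℕ} {f : ℂ[X]} (hf : f.natDegree ≤ n) {y : ℂ} (hy : y ≠ 0) :
    (conjReflect n f).eval y = y ^ n * star (f.eval (star y)⁻¹) := by
  have hx : star y ≠ 0 := by simpa using hy
  let _ : Invertible (y⁻¹) := invertibleOfNonzero (inv_ne_zero hy)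
  have := eval₂_reflect_mul_pow (RingHom.id ℂ) (y⁻¹) n (f.map (starRingEnd ℂ)) (by simpa using hf)
  rw [invOf_eq_inv, inv_inv] at this
  have h2 : eval₂ (RingHom.id ℂ) y⁻¹ (f.map (starRingEnd ℂ)) = star (f.eval (star y)⁻¹) := by
    change _ = starRingEnd ℂ (f.eval (star y)⁻¹)
    rw [eval₂_map, eval, hom_eval₂ f (RingHom.id ℂ) (starRingEnd ℂ)]
    simp
  rw [h2] at this
  unfold conjReflect
  rw [← this, eval, mul_comm, mul_assoc, ← mul_pow, inv_mul_cancel₀ hy, one_pow, mul_one]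

theorem eval_conjReflect_of_norm_eq_one {n : ℕ} {f : ℂ[X]} (hf : f.natDegree ≤ n) {y : ℂ}
    (hy : ‖y‖ = 1) : (conjReflect n f).eval y = y ^ n * star (f.eval y) := by
  have h0 : y ≠ 0 := by rintro rfl; simp at hy
  rw [eval_conjReflect hf h0]
  have : (star y)⁻¹ = y := by
    rw [inv_eq_iff_eq_inv, Complex.inv_eq_conj hy]; rfl
  rw [this]

/-- A form of the Fejér–Riesz theorem. -/
theorem exists_conjReflect_mul_eq (n : ℕ) (T : ℂ[X]) (hdeg : T.natDegree ≤ 2 * n)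
    (hself : conjReflect (2 * n) T = T)
    (hpos : ∀ y : ℂ, ‖y‖ = 1 → ∃ c : ℝ, 0 < c ∧ T.eval y = c * y ^ n) :
    ∃ Q : ℂ[X], Q.natDegree ≤ n ∧ Q * conjReflect n Q = T := by
  induction n generalizing T with
  | zero =>
    obtain ⟨c, hc, h⟩ := hpos 1 (by simp)
    rw [eq_C_of_natDegree_le_zero hdeg] at h ⊢
    simp at h
    refine ⟨C (Real.sqrt c : ℂ), by simp, ?_⟩
    simp only [conjReflect, map_C, Complex.conj_ofReal, reflect_C, pow_zero, mul_one, h, ← C_mul]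
    norm_cast
    rw [Real.mul_self_sqrt hc.le]
  | succ n ih =>
    by_cases h0 : T.coeff 0 = 0
    · obtain ⟨T', rfl⟩ := X_dvd_iff.2 h0
      by_cases hT : T' = 0
      · subst hT
        obtain ⟨c, hc, h⟩ := hpos 1 (by simp)
        simp at h
        exact absurd h.symm (by exact_mod_cast hc.ne')
      -- The constant coefficient vanishes, so by self-reflection the coefficient of degree `2 * (n
      -- + 1)` does too; both ends can be trimmed at once.
      have hd : (X * T').natDegree ≤ 2 * n + 1 := by
        rw [natDegree_le_iff_coeff_eq_zero]
        intro N hN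
        rcases (show 2 * (n+1) ≤ N by omega).eq_or_lt with h | h
        · rw [← hself, coeff_conjReflect h.ge, ← h]
          simp
        · exact coeff_eq_zero_of_natDegree_lt (hdeg.trans_lt h)
      have hd' : T'.natDegree ≤ 2 * n := by
        rw [natDegree_X_mul hT] at hd; omega
      have hs' : conjReflect (2 * n) T' = T' := by
        have h1 := conjReflect_X_mul (f := T') (n := 2 * n + 1) (by omega)
        rw [show 2 * n + 1 + 1 = 2 * (n + 1) by ring, hself, conjReflect_succ hd'] at h1
        exact (mul_left_cancel₀ X_ne_zero h1).symm
      obtain ⟨Q, hQ, hQT⟩ := ih T' hd' hs' (by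
        intro y hy
        obtain ⟨c, hc, h⟩ := hpos y hy
        refine ⟨c, hc, ?_⟩
        have h0 : y ≠ 0 := by rintro rfl; simp at hy
        simp at h
        apply mul_left_cancel₀ h0
        rw [h]; ring)
      -- The same `Q` serves: reflecting it one degree higher supplies the missing factor `X`.
      exact ⟨Q, by omega, by rw [conjReflect_succ hQ, ← hQT]; ring⟩
    · have hT0 : T ≠ 0 := by rintro rfl; simp at h0
      have hlead : T.coeff (2 * (n + 1)) ≠ 0 := by
        rw [← hself, coeff_conjReflect le_rfl]
        simpa using h0
      have hdeg' : T.degree ≠ 0 := by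
        intro h
        rw [eq_C_of_degree_eq_zero h, coeff_C_of_ne_zero (by omega)] at hlead
        exact hlead rfl
      obtain ⟨z, hz⟩ := Complex.exists_root (f := T) (by
        rw [degree_eq_natDegree hT0] at hdeg' ⊢
        exact_mod_cast Nat.pos_of_ne_zero (by exact_mod_cast hdeg'))
      have hz0 : z ≠ 0 := by
        rintro rfl
        rw [IsRoot, ← coeff_zero_eq_eval_zero] at hz
        exact h0 hz
      have hz1 : ‖z‖ ≠ 1 := by
        intro h1
        obtain ⟨c, hc, h⟩ := hpos z h1
        rw [hz.eq_zero] at h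
        have : (c : ℂ) ≠ 0 := by exact_mod_cast hc.ne'
        exact (mul_ne_zero this (pow_ne_zero _ hz0)) h.symm
      obtain ⟨T₁, rfl⟩ := dvd_iff_isRoot.2 hz
      -- Roots come in pairs `z`, `1 / conj z`, distinct because `z` is off the unit circle. The
      -- pair contributes `(X - z) * (1 - conj z * X)`, which is `X - z` times its own reflection.
      have hzi : ((X - C z) * T₁).eval (star z)⁻¹ = 0 := by
        rw [← hself, eval_conjReflect hdeg (by simpa using hz0)]
        simp
      have hne : (star z)⁻¹ - z ≠ 0 := by
        intro h
        rw [sub_eq_zero, inv_eq_iff_eq_inv] at h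
        have : star z * z = 1 := by rw [h, inv_mul_cancel₀ hz0]
        rw [mul_comm] at this
        have h2 : ((‖z‖ ^ 2 : ℝ) : ℂ) = 1 := by
          rw [← this]; push_cast; exact (Complex.mul_conj' z).symm
        have h3 : ‖z‖ ^ 2 = 1 := by exact_mod_cast h2
        exact hz1 ((pow_eq_one_iff_of_nonneg (norm_nonneg z) two_ne_zero).1 h3)
      have hr1 : T₁.IsRoot (star z)⁻¹ := by
        rw [eval_mul] at hzi
        simpa using (mul_eq_zero.1 hzi).resolve_left (by simpa using hne)
      obtain ⟨T₂, rfl⟩ := dvd_iff_isRoot.2 hr1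
      set D : ℂ[X] := 1 - C (star z) * X with hD
      have hDz : X - C (star z)⁻¹ = C (-(star z)⁻¹) * D := by
        have : star z ≠ 0 := by simpa using hz0
        rw [hD, mul_sub, ← mul_assoc, ← C_mul, neg_mul, inv_mul_cancel₀ this]
        simp only [C_neg, C_1]; ring
      set T' : ℂ[X] := C (-(star z)⁻¹) * T₂ with hT'
      have hfac : (X - C z) * ((X - C (star z)⁻¹) * T₂) = (X - C z) * D * T' := by
        rw [hDz, hT']; ring
      rw [hfac] at hdeg hself hpos hT0
      have hXz : (X - C z : ℂ[X]).natDegree ≤ 1 := by simp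
      have hrX : conjReflect 1 (X - C z) = D := by
        rw [hD]; unfold conjReflect
        rw [Polynomial.map_sub, map_X, map_C, reflect_sub]
        simp
      have hDd : D.natDegree ≤ 1 := by
        rw [← hrX]; exact natDegree_conjReflect_le hXz
      have hrD : conjReflect 1 D = X - C z := by rw [← hrX, conjReflect_conjReflect]
      have hD0 : D ≠ 0 := by
        intro h
        simp [h] at hT0
      have hX0 : (X - C z : ℂ[X]) ≠ 0 := X_sub_C_ne_zero z
      have hT'0 : T' ≠ 0 := by
        intro h; simp [h] at hT0
      have hDdeg : D.natDegree = 1 := by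
        have := congrArg natDegree hDz
        rw [natDegree_X_sub_C, natDegree_C_mul] at this
        · exact this.symm
        · simpa using hz0
      have hd' : T'.natDegree ≤ 2 * n := by
        rw [natDegree_mul (mul_ne_zero hX0 hD0) hT'0, natDegree_mul hX0 hD0,
          natDegree_X_sub_C, hDdeg] at hdeg
        omega
      have hs' : conjReflect (2 * n) T' = T' := by
        have h1 := conjReflect_mul (m := 2) (n := 2 * n) (f := (X - C z) * D) (g := T')
          (natDegree_mul_le.trans (by omega)) hd'
        have h2 := conjReflect_mul (m := 1) (n := 1) hXz hDd
        norm_num at h2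
        rw [h2, hrX, hrD, show 2 + 2 * n = 2 * (n + 1) by ring, hself, mul_comm D] at h1
        exact (mul_left_cancel₀ (mul_ne_zero hX0 hD0) h1).symm
      obtain ⟨Q, hQ, hQT⟩ := ih T' hd' hs' (by
        intro y hy
        obtain ⟨c, hc, h⟩ := hpos y hy
        have h0 : y ≠ 0 := by rintro rfl; simp at hy
        have hyz : y - z ≠ 0 := by
          intro h; rw [sub_eq_zero] at h; rw [h] at hy; exact hz1 hy
        have hyz' : 0 < ‖y - z‖ ^ 2 := by positivity
        refine ⟨c / ‖y - z‖ ^ 2, by positivity, ?_⟩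
        -- On the circle the removed factor equals `y * ‖y - z‖ ^ 2`, so the quotient stays positive
        -- after division by `y ^ n`.
        have hDy : D.eval y = y * star (y - z) := by
          rw [← hrX, eval_conjReflect_of_norm_eq_one hXz hy]; simp
        have hN : (y - z) * star (y - z) = ((‖y - z‖ ^ 2 : ℝ) : ℂ) := by
          push_cast; exact Complex.mul_conj' _
        rw [eval_mul, eval_mul, hDy] at h
        have h3 : y * (((‖y - z‖ ^ 2 : ℝ) : ℂ) * T'.eval y) = y * (c * y ^ n) := by
          rw [← hN]
          have : (X - C z).eval y = y - z := by simp
          rw [this] at h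
          linear_combination h
        have h4 := mul_left_cancel₀ h0 h3
        have h5 : ((‖y - z‖ ^ 2 : ℝ) : ℂ) ≠ 0 := by exact_mod_cast hyz'.ne'
        rw [Complex.ofReal_div, div_mul_eq_mul_div, eq_div_iff h5, ← h4]
        ring)
      refine ⟨(X - C z) * Q, natDegree_mul_le.trans (by omega), ?_⟩
      rw [add_comm n 1, conjReflect_mul hXz hQ, hrX, hfac, ← hQT]
      ring

/-- On the circle `X ^ n - P * conjReflect n P` takes the value `y ^ n * (1 - ‖P y‖ ^ 2)`. The
strict bound makes the second factor positive, so Fejér–Riesz applies. -/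
theorem exists_complementary_polynomial {n : ℕ} {P : ℂ[X]} (hP : P.natDegree ≤ n)
    (hlt : ∀ y : ℂ, ‖y‖ = 1 → ‖P.eval y‖ < 1) :
    ∃ Q : ℂ[X], Q.natDegree ≤ n ∧ P * conjReflect n P + Q * conjReflect n Q = X ^ n := by
  have hPP : (P * conjReflect n P).natDegree ≤ 2 * n :=
    natDegree_mul_le.trans (by have := natDegree_conjReflect_le hP; omega)
  obtain ⟨Q, hQ, h⟩ := exists_conjReflect_mul_eq n (X ^ n - P * conjReflect n P)
    ((natDegree_sub_le _ _).trans (max_le (by simp; omega) hPP)) (by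
      have h1 : conjReflect (2 * n) (P * conjReflect n P) = P * conjReflect n P := by
        rw [two_mul, conjReflect_mul hP (natDegree_conjReflect_le hP), conjReflect_conjReflect,
          mul_comm]
      have h2 : conjReflect (2 * n) (X ^ n) = X ^ n := by
        simp only [conjReflect, Polynomial.map_pow, map_X, reflect_monomial]
        rw [revAt_le (by omega)]
        congr 1; omega
      rw [sub_eq_add_neg, ← neg_one_mul (P * _), show (-1 : ℂ[X]) = C (-1) by simp,
        conjReflect_add, conjReflect_C_mul, h1, h2]
      simp) (by
      intro y hy
      refine ⟨1 - ‖P.eval y‖ ^ 2, ?_, ?_⟩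
      · have := hlt y hy
        nlinarith [norm_nonneg (P.eval y)]
      · rw [eval_sub, eval_mul, eval_conjReflect_of_norm_eq_one hP hy]
        have : P.eval y * star (P.eval y) = (‖P.eval y‖ ^ 2 : ℂ) := Complex.mul_conj' _
        simp only [eval_pow, eval_X]
        push_cast
        rw [← this]; ring)
  exact ⟨Q, hQ, by rw [h]; ring⟩

end HamSim

/-! ### Generalised quantum signal processing -/

namespace HamSim

open Polynomial

/-- The vectors obtained from `(1, 0)` by alternating the scalar matrices `A 0, A 1, …` with the
diagonal matrices with entries `s 0, s 1, …`. -/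
def qspColumn {R : Type*} [Ring R] [Algebra ℂ R] (A : ℕ → Matrix (Fin 2) (Fin 2) ℂ)
    (s : ℕ → Fin 2 → R) : ℕ → Fin 2 → R
  | 0 => fun c => A 0 c 0 • (1 : R)
  | n + 1 => fun c => ∑ c', A (n + 1) c c' • (s n c' * qspColumn A s n c')

theorem qspColumn_congr {R : Type*} [Ring R] [Algebra ℂ R] {A B : ℕ → Matrix (Fin 2) (Fin 2) ℂ}
    (s : ℕ → Fin 2 → R) (n : ℕ) (h : ∀ k ≤ n, A k = B k) :
    qspColumn A s n = qspColumn B s n := by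
  induction n with
  | zero => simp [qspColumn, h 0 le_rfl]
  | succ n ih => simp [qspColumn, h (n + 1) le_rfl, ih fun k hk => h k (by omega)]

/-- The special unitary matrix with first column `(a, b)`. -/
def columnUnitary (a b : ℂ) : Matrix (Fin 2) (Fin 2) ℂ := !![a, -star b; b, star a]

theorem columnUnitary_mem {a b : ℂ} (h : star a * a + star b * b = 1) :
    columnUnitary a b ∈ Matrix.unitaryGroup (Fin 2) ℂ := by
  rw [Matrix.mem_unitaryGroup_iff']
  ext i j
  fin_cases i <;> fin_cases j <;>
    simp [columnUnitary, Matrix.mul_apply, Matrix.star_apply] <;>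
    simp at h
  · exact h
  · ring
  · ring
  · linear_combination h

/-- Normalise `(p₁, q₁)`: the hypothesis says that it is orthogonal to `(p₀, q₀)`. If it is zero,
any unit vector orthogonal to `(p₀, q₀)` will do. -/
theorem exists_unit_vector_ratio {p₀ q₀ p₁ q₁ : ℂ} (h : p₀ * star p₁ + q₀ * star q₁ = 0) :
    ∃ a b : ℂ, star a * a + star b * b = 1 ∧ star a * p₀ + star b * q₀ = 0 ∧
      a * q₁ - b * p₁ = 0 := by
  have normalize : ∀ x y : ℂ, (x, y) ≠ 0 → ∃ r : ℝ, star (r * x) * (r * x) +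
      star (r * y) * (r * y) = 1 := by
    intro x y hxy
    have hpos : 0 < ‖x‖ ^ 2 + ‖y‖ ^ 2 := by
      by_contra hle
      have hx : ‖x‖ = 0 := by nlinarith [sq_nonneg ‖x‖, sq_nonneg ‖y‖]
      have hy : ‖y‖ = 0 := by nlinarith [sq_nonneg ‖x‖, sq_nonneg ‖y‖]
      exact hxy (by simp [norm_eq_zero.1 hx, norm_eq_zero.1 hy])
    have hx : star x * x = ((‖x‖ ^ 2 : ℝ) : ℂ) := by push_cast; exact Complex.conj_mul' x
    have hy : star y * y = ((‖y‖ ^ 2 : ℝ) : ℂ) := by push_cast; exact Complex.conj_mul' y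
    refine ⟨(Real.sqrt (‖x‖ ^ 2 + ‖y‖ ^ 2))⁻¹, ?_⟩
    set s := (Real.sqrt (‖x‖ ^ 2 + ‖y‖ ^ 2))⁻¹ with hs
    have hss : s * s * (‖x‖ ^ 2 + ‖y‖ ^ 2) = 1 := by
      rw [hs, ← mul_inv, Real.mul_self_sqrt hpos.le, inv_mul_cancel₀ hpos.ne']
    have hsc : star (s : ℂ) = s := Complex.conj_ofReal s
    rw [star_mul, star_mul, hsc]
    have : (s * s * (‖x‖ ^ 2 + ‖y‖ ^ 2) : ℂ) = 1 := by exact_mod_cast hss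
    push_cast at hx hy
    linear_combination (s * s : ℂ) * hx + (s * s : ℂ) * hy + this
  by_cases h1 : (p₁, q₁) = 0
  · obtain ⟨rfl, rfl⟩ : p₁ = 0 ∧ q₁ = 0 := by simpa using h1
    by_cases h0 : (p₀, q₀) = 0
    · obtain ⟨rfl, rfl⟩ : p₀ = 0 ∧ q₀ = 0 := by simpa using h0
      exact ⟨1, 0, by simp⟩
    · obtain ⟨r, hr⟩ := normalize (-star q₀) (star p₀) (by
        intro h
        apply h0
        simp only [Prod.mk_eq_zero, neg_eq_zero, star_eq_zero] at h ⊢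
        exact ⟨h.2, h.1⟩)
      refine ⟨_, _, hr, ?_, by simp⟩
      simp only [star_mul, star_neg, star_star]
      ring
  · obtain ⟨r, hr⟩ := normalize p₁ q₁ h1
    refine ⟨_, _, hr, ?_, by ring⟩
    have hrc : star (r : ℂ) = r := Complex.conj_ofReal r
    simp only [star_mul, hrc]
    linear_combination (r : ℂ) * h

/-- Layers are stripped by induction. The constant coefficient of the identity makes the lowest and
the highest coefficient vectors of `(P, Q)` orthogonal. One unitary therefore cancels the constant
term of the first component and the top term of the second. Dividing the first component by `X`
leaves a pair of degree `n` satisfying the same identity. -/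
theorem exists_qspColumn_eq (n : ℕ) (P Q : ℂ[X]) (hP : P.natDegree ≤ n) (hQ : Q.natDegree ≤ n)
    (h : P * conjReflect n P + Q * conjReflect n Q = X ^ n) :
    ∃ A : ℕ → Matrix (Fin 2) (Fin 2) ℂ, (∀ k, A k ∈ Matrix.unitaryGroup (Fin 2) ℂ) ∧
      qspColumn A (fun _ => ![X, 1]) n = ![P, Q] := by
  induction n generalizing P Q with
  | zero =>
    rw [eq_C_of_natDegree_le_zero hP, eq_C_of_natDegree_le_zero hQ] at h ⊢
    generalize P.coeff 0 = p at *
    generalize Q.coeff 0 = q at *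
    refine ⟨fun _ => columnUnitary p q, fun _ => columnUnitary_mem ?_, ?_⟩
    · have := congrArg (eval 0) h
      simp [conjReflect, -map_mul] at this
      simp
      linear_combination this
    · ext1 c
      fin_cases c <;> simp [qspColumn, columnUnitary, smul_eq_C_mul]
  | succ n ih =>
    have h0 : P.coeff 0 * star (P.coeff (n + 1)) + Q.coeff 0 * star (Q.coeff (n + 1)) = 0 := by
      have := congrArg (fun f => coeff f 0) h
      simpa [mul_coeff_zero, coeff_conjReflect] using this
    obtain ⟨a, b, hab, hv0, hv1⟩ := exists_unit_vector_ratio h0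
    obtain ⟨P', hP'⟩ : X ∣ C (star a) * P + C (star b) * Q := by
      rw [X_dvd_iff]; simpa using hv0
    set Q' := C a * Q - C b * P with hQ'
    have hXP : (X * P').natDegree ≤ n + 1 := by
      rw [← hP']
      exact natDegree_add_le_of_degree_le (natDegree_C_mul_le _ _ |>.trans hP)
        (natDegree_C_mul_le _ _ |>.trans hQ)
    have hdP : P'.natDegree ≤ n := by
      by_cases h : P' = 0
      · simp [h]
      · rw [natDegree_X_mul h] at hXP; omega
    have hdQ : Q'.natDegree ≤ n := by
      rw [natDegree_le_iff_coeff_eq_zero]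
      intro N hN
      rcases (show n + 1 ≤ N from hN).eq_or_lt with rfl | hlt
      · simpa [hQ'] using hv1
      · simp [hQ', coeff_eq_zero_of_natDegree_lt (hP.trans_lt hlt),
          coeff_eq_zero_of_natDegree_lt (hQ.trans_lt hlt)]
    have habC : C (star a) * C a + C (star b) * C b = (1 : ℂ[X]) := by
      rw [← C_mul, ← C_mul, ← C_add, hab, C_1]
    have hPeq : P = C a * (X * P') + C (-star b) * Q' := by
      rw [← hP', hQ', C_neg]
      linear_combination (-P) * habC
    have hQeq : Q = C b * (X * P') + C (star a) * Q' := by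
      rw [← hP', hQ']
      linear_combination (-Q) * habC
    have hrec : P' * conjReflect n P' + Q' * conjReflect n Q' = X ^ n := by
      have hPr : conjReflect (n + 1) P =
          C (star a) * conjReflect n P' - C b * (X * conjReflect n Q') := by
        rw [hPeq, conjReflect_add, conjReflect_C_mul, conjReflect_C_mul, conjReflect_X_mul hdP,
          conjReflect_succ hdQ, star_neg, star_star, C_neg]
        ring
      have hQr : conjReflect (n + 1) Q =
          C (star b) * conjReflect n P' + C a * (X * conjReflect n Q') := by
        rw [hQeq, conjReflect_add, conjReflect_C_mul, conjReflect_C_mul, conjReflect_X_mul hdP,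
          conjReflect_succ hdQ, star_star]
      rw [hPr, hQr] at h
      nth_rewrite 1 [hPeq] at h
      nth_rewrite 1 [hQeq] at h
      rw [C_neg] at h
      apply mul_left_cancel₀ (X_ne_zero (R := ℂ))
      rw [← pow_succ', ← h]
      linear_combination (-(X * (P' * conjReflect n P' + Q' * conjReflect n Q'))) * habC
    obtain ⟨A, hA, hcol⟩ := ih P' Q' hdP hdQ hrec
    -- The shorter product uses only the matrices of index at most `n`, so overwriting index `n + 1`
    -- is harmless.
    refine ⟨Function.update A (n + 1) (columnUnitary a b), ?_, ?_⟩
    · intro k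
      rcases eq_or_ne k (n + 1) with rfl | hk
      · simpa using columnUnitary_mem hab
      · simpa [hk] using hA k
    · rw [qspColumn, qspColumn_congr (B := A) _ n fun k hk => by
        rw [Function.update_of_ne (by omega)], hcol]
      ext1 c
      fin_cases c
      · simp [columnUnitary, smul_eq_C_mul]
        rw [hPeq]; simp
      · simp [columnUnitary, smul_eq_C_mul]
        rw [hQeq]; simp

/-- Generalized quantum signal processing: a polynomial that is bounded by `1` on the unit circle
is the first entry of an alternating product of unitary matrices and signal matrices. -/
theorem exists_qspColumn_apply_zero_eq {n : ℕ} {P : ℂ[X]} (hP : P.natDegree ≤ n)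
    (hlt : ∀ y : ℂ, ‖y‖ = 1 → ‖P.eval y‖ < 1) :
    ∃ A : ℕ → Matrix (Fin 2) (Fin 2) ℂ, (∀ k, A k ∈ Matrix.unitaryGroup (Fin 2) ℂ) ∧
      qspColumn A (fun _ => ![X, 1]) n 0 = P := by
  obtain ⟨Q, hQ, h⟩ := exists_complementary_polynomial hP hlt
  obtain ⟨A, hA, hcol⟩ := exists_qspColumn_eq n P Q hP hQ h
  exact ⟨A, hA, by rw [hcol]; rfl⟩

end HamSim

namespace HamSim

open Polynomial

/-! ### Chebyshev interpolation -/

/-- Iterated Rolle; `F` is the sequence of successive derivatives of one function. -/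
theorem exists_eq_zero_of_strictMono {F : ℕ → ℝ → ℝ}
    (hF : ∀ k x, HasDerivAt (F k) (F (k + 1) x) x) (n : ℕ) (x : Fin (n + 1) → ℝ)
    (hx : StrictMono x) (h0 : ∀ i, F 0 (x i) = 0) : ∃ ξ, F n ξ = 0 := by
  induction n generalizing F with
  | zero => exact ⟨x 0, h0 0⟩
  | succ n ih =>
    have hy : ∀ i : Fin (n + 1), ∃ y ∈ Set.Ioo (x i.castSucc) (x i.succ), F 1 y = 0 := fun i =>
      exists_hasDerivAt_eq_zero (hx Fin.castSucc_lt_succ)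
        (fun z _ => (hF 0 z).continuousAt.continuousWithinAt) (by rw [h0, h0]) fun z _ => hF 0 z
    choose y hy hy0 using hy
    refine ih (F := fun k => F (k + 1)) (fun k => hF (k + 1)) y ?_ hy0
    rw [Fin.strictMono_iff_lt_succ]
    intro i
    exact (hy i.castSucc).2.trans ((hy i.succ).1.trans_le' (by simp))

theorem exists_eq_zero_of_card {F : ℕ → ℝ → ℝ}
    (hF : ∀ k x, HasDerivAt (F k) (F (k + 1) x) x) {n : ℕ} (s : Finset ℝ) (hs : s.card = n + 1)
    (h0 : ∀ x ∈ s, F 0 x = 0) : ∃ ξ, F n ξ = 0 :=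
  exists_eq_zero_of_strictMono hF n (s.orderEmbOfFin hs) (s.orderEmbOfFin hs).strictMono
    fun i => h0 _ (s.orderEmbOfFin_mem hs i)

theorem eval_iterate_derivative_T (n : ℕ) (x : ℝ) :
    (derivative^[n] (Chebyshev.T ℝ n)).eval x = n.factorial * 2 ^ (n - 1) := by
  have hd : (Chebyshev.T ℝ (n : ℤ)).natDegree = n := by simp
  have h : (derivative^[n] (Chebyshev.T ℝ n)).natDegree ≤ 0 :=
    (natDegree_iterate_derivative _ _).trans (by rw [hd]; simp)
  have hl : (Chebyshev.T ℝ (n : ℤ)).coeff n = 2 ^ (n - 1) := by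
    have := Chebyshev.leadingCoeff_T ℝ (n : ℤ)
    rwa [leadingCoeff, hd] at this
  rw [eq_C_of_natDegree_le_zero h, coeff_iterate_derivative]
  simp [hl, Nat.descFactorial_self]

/-- Interpolate at the `n + 1` zeros of the Chebyshev polynomial of degree `n + 1`. Its leading
coefficient `2 ^ n` and its bound `1` on `[-1, 1]` give the denominator of the remainder. -/
theorem exists_polynomial_near {F : ℕ → ℝ → ℝ}
    (hF : ∀ k x, HasDerivAt (F k) (F (k + 1) x) x) {n : ℕ} {B : ℝ}
    (hB : ∀ x, |F (n + 1) x| ≤ B) :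
    ∃ p : ℝ[X], p.natDegree ≤ n ∧
      ∀ x ∈ Set.Icc (-1 : ℝ) 1, |p.eval x - F 0 x| ≤ B / ((n + 1).factorial * 2 ^ n) := by
  set T := Chebyshev.T ℝ ((n + 1 : ℕ) : ℤ) with hT
  have hT0 : T ≠ 0 := by
    intro h
    have := Chebyshev.natDegree_T ℝ ((n + 1 : ℕ) : ℤ)
    rw [← hT, h] at this
    simp at this
    omega
  set s : Finset ℝ := (Finset.range (n + 1)).image
    fun k : ℕ => Real.cos ((2 * k + 1) * Real.pi / (2 * (n + 1 : ℕ))) with hs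
  have hroots : T.roots = s.val := Chebyshev.roots_T_real (n + 1)
  have hcard : s.card = n + 1 := by
    rw [hs, Finset.card_image_of_injOn, Finset.card_range]
    exact (Finset.range (n + 1)).nodup_map_iff_injOn.mp (Chebyshev.roots_T_real_nodup (n + 1))
  have hmem : ∀ x, x ∈ s ↔ T.eval x = 0 := by
    intro x
    rw [← Finset.mem_val, ← hroots, mem_roots hT0, IsRoot]
  have hinj : Set.InjOn (id : ℝ → ℝ) s := Function.injective_id.injOn
  set p := Lagrange.interpolate s id (F 0) with hp
  have hpd : p.degree < (n + 1 : ℕ) := by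
    rw [← hcard]; exact Lagrange.degree_interpolate_lt _ hinj
  have hpn : p.natDegree ≤ n := by
    by_cases h : p = 0
    · simp [h]
    · rw [degree_eq_natDegree h] at hpd
      have : p.natDegree < n + 1 := by exact_mod_cast hpd
      omega
  have hpe : ∀ x ∈ s, p.eval x = F 0 x := fun x hx =>
    Lagrange.eval_interpolate_at_node _ hinj hx
  have hB0 : 0 ≤ B := (abs_nonneg _).trans (hB 0)
  refine ⟨p, hpn, fun x hx => ?_⟩
  by_cases hxs : x ∈ s
  · rw [hpe x hxs, sub_self, abs_zero]; positivity
  have hTx : T.eval x ≠ 0 := fun h => hxs ((hmem x).2 h)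
  -- With this `c`, the function `F 0 - p - c * T` vanishes at `x` as well as at the nodes. It has
  -- `n + 2` zeros, and its derivative of order `n + 1` vanishes somewhere; this determines `c`.
  set c := (F 0 x - p.eval x) / T.eval x with hc
  obtain ⟨ξ, hξ⟩ := exists_eq_zero_of_card (n := n + 1)
    (F := fun k y => F k y - (derivative^[k] (p + C c * T)).eval y)
    (fun k y => by
      rw [Function.iterate_succ_apply']
      exact (hF k y).sub (Polynomial.hasDerivAt _ y)) (insert x s)
    (by rw [Finset.card_insert_of_notMem hxs, hcard]) (by
      intro y hy
      rcases Finset.mem_insert.1 hy with rfl | hy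
      · simp [hc, div_mul_cancel₀ _ hTx]
      · simp [hpe y hy, (hmem y).1 hy])
  simp only [iterate_map_add, iterate_derivative_eq_zero (show p.natDegree < n + 1 by omega),
    iterate_derivative_C_mul, eval_add, eval_mul, eval_C, eval_zero, hT,
    eval_iterate_derivative_T] at hξ
  have hcle : |c| ≤ B / ((n + 1).factorial * 2 ^ n) := by
    have hpos : (0 : ℝ) < (n + 1).factorial * 2 ^ n := by positivity
    rw [le_div_iff₀ hpos]
    have h := hB ξ
    rw [show F (n + 1) ξ = c * ((n + 1).factorial * 2 ^ n) by simpa [sub_eq_zero] using hξ,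
      abs_mul, abs_of_pos hpos] at h
    exact h
  have hxc : p.eval x - F 0 x = -(c * T.eval x) := by
    rw [hc, div_mul_cancel₀ _ hTx]; ring
  rw [hxc, abs_neg, abs_mul]
  have := Chebyshev.abs_eval_T_real_le_one ((n + 1 : ℕ) : ℤ) (abs_le.2 hx)
  calc |c| * |T.eval x| ≤ |c| * 1 := by gcongr
    _ ≤ _ := by rwa [mul_one]

theorem coeff_comp_neg_X (p : ℝ[X]) (k : ℕ) : (p.comp (-X)).coeff k = (-1) ^ k * p.coeff k := by
  rw [show (-X : ℝ[X]) = C (-1) * X by simp, comp_C_mul_X_coeff, mul_comm]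

/-- Approximants of functions with a parity may be taken with the same parity. -/
theorem exists_polynomial_parity {f : ℝ → ℝ} {a n : ℕ} {δ : ℝ}
    (hf : ∀ x, f (-x) = (-1) ^ a * f x) {p : ℝ[X]} (hp : p.natDegree ≤ n)
    (hpf : ∀ x ∈ Set.Icc (-1 : ℝ) 1, |p.eval x - f x| ≤ δ) :
    ∃ q : ℝ[X], q.natDegree ≤ n ∧ (∀ k, k % 2 ≠ a % 2 → q.coeff k = 0) ∧
      ∀ x ∈ Set.Icc (-1 : ℝ) 1, |q.eval x - f x| ≤ δ := by
  -- Averaging `p` with its signed mirror image kills the coefficients of wrong parity, and the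
  -- triangle inequality keeps the error.
  refine ⟨C (1 / 2) * (p + C ((-1) ^ a) * p.comp (-X)), ?_, ?_, ?_⟩
  · refine (natDegree_C_mul_le _ _).trans (natDegree_add_le_of_degree_le hp
      ((natDegree_C_mul_le _ _).trans ?_))
    rw [natDegree_comp]; simpa
  · intro k hk
    rw [coeff_C_mul, coeff_add, coeff_C_mul, coeff_comp_neg_X, ← mul_assoc, ← pow_add,
      Odd.neg_one_pow (Nat.odd_iff.2 (by omega))]
    ring
  · intro x hx
    have h1 := hpf x hx
    have h2 := hpf (-x) ⟨by linarith [hx.2], by linarith [hx.1]⟩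
    rw [hf] at h2
    have h3 : ((-1 : ℝ) ^ a) * (-1) ^ a = 1 := by rw [← mul_pow]; simp
    have h4 : |(-1 : ℝ) ^ a| = 1 := by simp
    have : (C (1 / 2) * (p + C ((-1) ^ a) * p.comp (-X))).eval x - f x =
        (1 / 2) * ((p.eval x - f x) + (-1) ^ a * (p.eval (-x) - (-1) ^ a * f x)) := by
      simp only [eval_mul, eval_add, eval_C, eval_comp, eval_neg, eval_X]
      linear_combination (1 / 2) * f x * h3
    rw [this, abs_mul]
    have h5 := abs_add_le (p.eval x - f x) ((-1) ^ a * (p.eval (-x) - (-1) ^ a * f x))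
    rw [abs_mul ((-1) ^ a), h4, one_mul] at h5
    norm_num
    linarith

theorem hasDerivAt_pow_mul_cos (t φ : ℝ) (k : ℕ) (x : ℝ) :
    HasDerivAt (fun x => t ^ k * Real.cos (t * x + φ + k * (Real.pi / 2)))
      (t ^ (k + 1) * Real.cos (t * x + φ + (k + 1 : ℕ) * (Real.pi / 2))) x := by
  have h : HasDerivAt (fun x => t * x + φ + k * (Real.pi / 2)) t x := by
    simpa using (((hasDerivAt_id x).const_mul t).add_const φ).add_const (k * (Real.pi / 2))
  refine ((h.cos).const_mul (t ^ k)).congr_deriv ?_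
  push_cast
  rw [show t * x + φ + (k + 1) * (Real.pi / 2) = t * x + φ + k * (Real.pi / 2) + Real.pi / 2 by
    ring, Real.cos_add_pi_div_two]
  ring

/-- The phase `φ` lets one statement serve the cosine (`φ = 0`) and the sine (`φ = -π / 2`):
differentiation only shifts the phase and multiplies by `t`. -/
theorem exists_polynomial_near_cos {t : ℝ} (ht : 0 < t) (φ : ℝ) {a : ℕ} (n : ℕ)
    (hφ : ∀ x, Real.cos (t * -x + φ) = (-1) ^ a * Real.cos (t * x + φ)) :
    ∃ q : ℝ[X], q.natDegree ≤ n ∧ (∀ k, k % 2 ≠ a % 2 → q.coeff k = 0) ∧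
      ∀ x ∈ Set.Icc (-1 : ℝ) 1,
        |q.eval x - Real.cos (t * x + φ)| ≤ t ^ (n + 1) / ((n + 1).factorial * 2 ^ n) := by
  obtain ⟨p, hp, hpf⟩ := exists_polynomial_near (n := n) (B := t ^ (n + 1))
    (hasDerivAt_pow_mul_cos t φ) (fun x => by
      rw [abs_mul, abs_of_pos (pow_pos ht _)]
      exact mul_le_of_le_one_right (by positivity) (Real.abs_cos_le_one _))
  exact exists_polynomial_parity (f := fun x => Real.cos (t * x + φ)) hφ hp
    (by simpa using hpf)

/-- By `N ^ N / N! ≤ e ^ N`, the main factor `(t / 2) ^ N / N!` is at most `(t' / N) ^ N` with `t' =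
e t / 2`. This is at most `ε / 24`, because `N ≥ r > t'` decreases the base and raises the exponent
of a number below `1`. The leftover factor is `2 * (t / 2) / (N + 1) < 2 / 2.7`, and `24 * 2.7 / 2 =
32.4`. -/
theorem truncation_error_lt {t ε : ℝ} (ht : 0 < t) (hε : 0 < ε) (hε1 : ε < 24) {N : ℕ}
    (hN : rate (Real.exp 1 * t / 2) (ε / 24) ≤ N) :
    t ^ (N + 1) / ((N + 1).factorial * 2 ^ N) < ε / 32 := by
  set t' := Real.exp 1 * t / 2 with ht'
  have ht'0 : 0 < t' := by positivity
  obtain ⟨hr, hre⟩ := rate_spec ht'0 (show 0 < ε / 24 by positivity) (by linarith)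
  set r := rate t' (ε / 24)
  have hr0 : 0 < r := ht'0.trans hr
  have hN0 : (0 : ℝ) < N := hr0.trans_le hN
  have h1 : (t' / N) ^ N ≤ ε / 24 := by
    rw [← hre]
    calc (t' / N) ^ N ≤ (t' / r) ^ N := by gcongr
      _ = (t' / r) ^ (N : ℝ) := (Real.rpow_natCast _ _).symm
      _ ≤ _ := Real.rpow_le_rpow_of_exponent_ge (by positivity)
        ((div_le_one hr0).2 hr.le) hN
  have h2 : (t / 2) ^ N / N.factorial ≤ (t' / N) ^ N := by
    have h := Real.pow_div_factorial_le_exp _ hN0.le N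
    rw [div_le_iff₀ (by positivity)] at h
    rw [div_pow t', div_le_div_iff₀ (by positivity) (by positivity), ht',
      show Real.exp 1 * t / 2 = Real.exp 1 * (t / 2) by ring, mul_pow, ← Real.exp_nat_mul,
      mul_one, mul_comm (Real.exp _), mul_assoc]
    gcongr
  have h3 : t / 2 / (N + 1) < 1 / 2.7 := by
    have he := Real.exp_one_gt_d9
    have : t / 2 * 2.7 ≤ t' := by rw [ht']; nlinarith
    rw [div_lt_div_iff₀ (by positivity) (by norm_num)]
    linarith
  have h4 : t ^ (N + 1) / ((N + 1).factorial * 2 ^ N) =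
      2 * ((t / 2) ^ N / N.factorial) * (t / 2 / (N + 1)) := by
    rw [Nat.factorial_succ, div_pow, pow_succ]; push_cast
    field_simp
  rw [h4]
  calc 2 * ((t / 2) ^ N / N.factorial) * (t / 2 / (N + 1))
      ≤ 2 * (ε / 24) * (t / 2 / (N + 1)) := by
        have := h2.trans h1
        gcongr
    _ < 2 * (ε / 24) * (1 / 2.7) := by gcongr
    _ < ε / 32 := by linarith

/-- An approximant may exceed `1` by `δ`. Shrinking restores the strict bound needed for a
complementary polynomial and at most doubles the error. -/
theorem abs_scaled_lt_one {q c δ : ℝ} (h : |q - c| < δ) (hc : |c| ≤ 1) :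
    |(1 + δ)⁻¹ * q| < 1 ∧ |(1 + δ)⁻¹ * q - c| ≤ 2 * δ := by
  have hδ : 0 < δ := (abs_nonneg _).trans_lt h
  have hp : 0 < (1 + δ)⁻¹ := by positivity
  rw [abs_lt] at h
  rw [abs_le] at hc
  constructor
  · rw [abs_mul, abs_of_pos hp, inv_mul_lt_iff₀ (by positivity), abs_lt]
    constructor <;> linarith
  · have : (1 + δ)⁻¹ * q - c = (1 + δ)⁻¹ * (q - c - δ * c) := by field_simp; ring
    rw [this, abs_mul, abs_of_pos hp, inv_mul_le_iff₀ (by positivity), abs_le]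
    constructor <;> nlinarith

/-- The exponential `exp (i t x)` is approximated on `[-1, 1]` by the sum of two polynomials of
opposite parity and of norm less than `1`. -/
theorem exists_polynomials_near_exp {t ε : ℝ} (ht : 0 < t) (hε : 0 < ε) (hε1 : ε < 24) {N : ℕ}
    (hN : rate (Real.exp 1 * t / 2) (ε / 24) ≤ N) :
    ∃ F : ℕ → ℂ[X], (∀ a, (F a).natDegree ≤ N ∧ (∀ k, k % 2 ≠ a % 2 → (F a).coeff k = 0) ∧
      ∀ x : ℝ, |x| ≤ 1 → ‖(F a).eval (x : ℂ)‖ < 1) ∧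
      ∀ a, ∀ x : ℝ, |x| ≤ 1 →
        ‖(F a).eval (x : ℂ) + (F (a + 1)).eval (x : ℂ) - Complex.exp (Complex.I * t * x)‖
          ≤ ε / 8 := by
  have hlt := truncation_error_lt ht hε hε1 hN
  obtain ⟨p, hpd, hpp, hpf⟩ := exists_polynomial_near_cos ht 0 (a := 0) N (by simp)
  obtain ⟨q, hqd, hqp, hqf⟩ := exists_polynomial_near_cos ht (-(Real.pi / 2)) (a := 1) N (by
    intro x
    rw [← sub_eq_add_neg, ← sub_eq_add_neg, Real.cos_sub_pi_div_two, Real.cos_sub_pi_div_two]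
    simp)
  set δ := ε / 32 with hδ
  have key : ∀ (p : ℝ[X]) (u c : ℂ) (x : ℝ), (C u * (C (1 + δ)⁻¹ * p).map
      (algebraMap ℝ ℂ)).eval (x : ℂ) - u * c = u * (((1 + δ)⁻¹ * p.eval x : ℝ) - c) := by
    intro p u c x
    have : ((C (1 + δ)⁻¹ * p).map (algebraMap ℝ ℂ)).eval (x : ℂ) =
        (((1 + δ)⁻¹ * p.eval x : ℝ) : ℂ) := by
      have := eval_map_algebraMap (C (1 + δ)⁻¹ * p) (x : ℂ)
      rw [this, show (x : ℂ) = algebraMap ℝ ℂ x from rfl, aeval_algebraMap_apply]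
      simp
    rw [eval_mul, eval_C, this]
    ring
  set P : ℂ[X] := C 1 * (C (1 + δ)⁻¹ * p).map (algebraMap ℝ ℂ) with hP
  set Q : ℂ[X] := C Complex.I * (C (1 + δ)⁻¹ * q).map (algebraMap ℝ ℂ) with hQ
  have hPx : ∀ x : ℝ, |x| ≤ 1 → ‖P.eval (x : ℂ)‖ < 1 ∧
      ‖P.eval (x : ℂ) - Real.cos (t * x)‖ ≤ 2 * δ := by
    intro x hx
    have h := abs_scaled_lt_one ((hpf x (abs_le.1 hx)).trans_lt hlt) (Real.abs_cos_le_one _)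
    have h1 := key p 1 0 x
    have h2 := key p 1 (Real.cos (t * x)) x
    rw [mul_zero, sub_zero, one_mul, sub_zero] at h1
    rw [one_mul, one_mul, ← Complex.ofReal_sub] at h2
    rw [h2, h1, Complex.norm_real, Complex.norm_real]
    simpa using h
  have hQx : ∀ x : ℝ, |x| ≤ 1 → ‖Q.eval (x : ℂ)‖ < 1 ∧
      ‖Q.eval (x : ℂ) - Complex.I * Real.sin (t * x)‖ ≤ 2 * δ := by
    intro x hx
    have h := abs_scaled_lt_one ((hqf x (abs_le.1 hx)).trans_lt hlt) (Real.abs_cos_le_one _)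
    rw [← sub_eq_add_neg, Real.cos_sub_pi_div_two] at h
    have h1 := key q Complex.I 0 x
    have h2 := key q Complex.I (Real.sin (t * x)) x
    rw [mul_zero, sub_zero, sub_zero] at h1
    rw [← Complex.ofReal_sub] at h2
    rw [h2, h1, norm_mul, norm_mul, Complex.norm_real, Complex.norm_real, Complex.norm_I]
    simpa using h
  have hPd : P.natDegree ≤ N := (natDegree_C_mul_le _ _).trans
    (natDegree_map_le.trans ((natDegree_C_mul_le _ _).trans hpd))
  have hQd : Q.natDegree ≤ N := (natDegree_C_mul_le _ _).trans
    (natDegree_map_le.trans ((natDegree_C_mul_le _ _).trans hqd))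
  have hsum : ∀ x : ℝ, |x| ≤ 1 →
      ‖P.eval (x : ℂ) + Q.eval (x : ℂ) - Complex.exp (Complex.I * t * x)‖ ≤ ε / 8 := by
    intro x hx
    have : Complex.exp (Complex.I * t * x) =
        Real.cos (t * x) + Complex.I * Real.sin (t * x) := by
      rw [show Complex.I * t * x = ((t * x : ℝ) : ℂ) * Complex.I by push_cast; ring,
        Complex.exp_mul_I]
      push_cast; ring
    rw [this, add_sub_add_comm]
    refine (norm_add_le _ _).trans ?_
    linarith [(hPx x hx).2, (hQx x hx).2]
  -- Indexing the two polynomials by parity avoids a later case distinction on the parity of the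
  -- circuit length.
  refine ⟨fun a => if a % 2 = 0 then P else Q, fun a => ?_, fun a => ?_⟩
  · rcases Nat.mod_two_eq_zero_or_one a with ha | ha
    · simp only [ha, if_true]
      exact ⟨hPd, fun k hk => by simp [hP, hpp k hk], fun x hx => (hPx x hx).1⟩
    · simp only [ha, one_ne_zero, if_false]
      exact ⟨hQd, fun k hk => by simp [hQ, hqp k hk], fun x hx => (hQx x hx).1⟩
  · intro x hx
    rcases Nat.mod_two_eq_zero_or_one a with ha | ha
    · have hb : (a + 1) % 2 = 1 := by omega
      simp only [ha, hb, if_true, one_ne_zero, if_false]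
      exact hsum x hx
    · have hb : (a + 1) % 2 = 0 := by omega
      simp only [ha, hb, if_true, one_ne_zero, if_false]
      rw [add_comm (Q.eval _)]
      exact hsum x hx

/-! ### Laurent form of polynomials with a parity -/

/-- The polynomial `P` with `z ^ n * F ((z + 1 / z) / 2) = P (z ^ 2)`, for `F` of degree at most
`n` and of the parity of `n`. -/
noncomputable def laurentForm (n : ℕ) (F : ℂ[X]) : ℂ[X] :=
  ∑ k ∈ Finset.range (n + 1), C (F.coeff k) * (X ^ ((n - k) / 2) * (C (1 / 2) * (X + 1)) ^ k)

theorem natDegree_laurentForm_le (n : ℕ) (F : ℂ[X]) : (laurentForm n F).natDegree ≤ n := by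
  refine natDegree_sum_le_of_forall_le _ _ fun k hk => ?_
  rw [Finset.mem_range] at hk
  refine (natDegree_C_mul_le _ _).trans (natDegree_mul_le.trans ?_)
  have h1 : (C (1 / 2) * (X + 1) : ℂ[X]).natDegree ≤ 1 :=
    (natDegree_C_mul_le _ _).trans (by rw [← C_1, natDegree_X_add_C])
  have h2 := natDegree_pow_le_of_le k h1
  rw [natDegree_X_pow]
  omega

/-- The defining property of `laurentForm`, for an invertible element of an algebra. -/
theorem aeval_laurentForm {R : Type*} [Ring R] [Algebra ℂ R] {n : ℕ} {F : ℂ[X]}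
    (hd : F.natDegree ≤ n) (hpar : ∀ k, k % 2 ≠ n % 2 → F.coeff k = 0) {z w : R}
    (hzw : z * w = 1) (hwz : w * z = 1) :
    w ^ n * aeval (z ^ 2) (laurentForm n F) = aeval ((1 / 2 : ℂ) • (z + w)) F := by
  have hc : Commute w z := by rw [Commute, SemiconjBy, hzw, hwz]
  rw [aeval_eq_sum_range' (Nat.lt_succ_of_le hd), laurentForm, map_sum, Finset.mul_sum]
  refine Finset.sum_congr rfl fun k hk => ?_
  rw [Finset.mem_range] at hk
  by_cases hkn : k % 2 = n % 2
  · have hk2 : 2 * ((n - k) / 2) = n - k := by omega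
    have h1 : w ^ n * (z ^ 2) ^ ((n - k) / 2) = w ^ k := by
      rw [← pow_mul, hk2]
      nth_rewrite 1 [show n = k + (n - k) by omega]
      rw [pow_add, mul_assoc, ← hc.mul_pow, hwz, one_pow, mul_one]
    have h2 : w * (z ^ 2 + 1) = z + w := by
      rw [mul_add, pow_two, ← mul_assoc, hwz, one_mul, mul_one]
    have hc2 : Commute w ((1 / 2 : ℂ) • (z ^ 2 + 1)) :=
      ((hc.pow_right 2).add_right (Commute.one_right _)).smul_right _
    simp only [map_mul, aeval_C, map_pow, aeval_X, map_add, map_one]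
    rw [Algebra.algebraMap_eq_smul_one, Algebra.algebraMap_eq_smul_one, smul_mul_assoc, one_mul,
      smul_mul_assoc, one_mul, mul_smul_comm, ← mul_assoc, h1, ← hc2.mul_pow, mul_smul_comm, h2]
  · rw [hpar k hkn]; simp

theorem norm_eval_laurentForm_lt_one {n : ℕ} {F : ℂ[X]} (hd : F.natDegree ≤ n)
    (hpar : ∀ k, k % 2 ≠ n % 2 → F.coeff k = 0)
    (hF : ∀ x : ℝ, |x| ≤ 1 → ‖F.eval (x : ℂ)‖ < 1) {y : ℂ} (hy : ‖y‖ = 1) :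
    ‖(laurentForm n F).eval y‖ < 1 := by
  obtain ⟨z, hz⟩ := IsAlgClosed.exists_pow_nat_eq y (n := 2) (by norm_num)
  have hz1 : ‖z‖ = 1 := by
    rw [← hz, norm_pow] at hy
    exact (pow_eq_one_iff_of_nonneg (norm_nonneg z) two_ne_zero).1 hy
  have hz0 : z ≠ 0 := by rintro rfl; simp at hz1
  have h := aeval_laurentForm hd hpar (mul_inv_cancel₀ hz0) (inv_mul_cancel₀ hz0)
  -- For a square root `z` of `y`, the argument of `F` is `Re z`, a point of `[-1, 1]`, and the
  -- factor `z ^ (-n)` has modulus `1`.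
  have hx : (1 / 2 : ℂ) • (z + z⁻¹) = (z.re : ℂ) := by
    rw [Complex.inv_eq_conj hz1, Complex.add_conj, smul_eq_mul]; push_cast; ring
  rw [hx, hz, coe_aeval_eq_eval] at h
  have h1 := congrArg norm h
  rw [norm_mul, norm_pow, norm_inv, hz1, inv_one, one_pow, one_mul] at h1
  rw [h1]
  exact hF _ (hz1 ▸ Complex.abs_re_le_norm z)

end HamSim

/-! ### The walk operator and transformation of the encoded matrix -/

namespace HamSim

open Polynomial
open scoped Matrix

section Walk

variable {M : Type*} [Ring M]

/-- The `2 × 2` block matrix with off-diagonal blocks `a` and `b`. -/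
def offDiag (a b : M) : Matrix (Fin 2) (Fin 2) M := !![0, a; b, 0]

theorem offDiag_mul_apply_zero (a b : M) (Y : Matrix (Fin 2) (Fin 2) M) (j : Fin 2) :
    (offDiag a b * Y) 0 j = a * Y 1 j := by
  simp [offDiag, Matrix.mul_apply, -Matrix.cons_mul]

theorem offDiag_mul_apply_one (a b : M) (Y : Matrix (Fin 2) (Fin 2) M) (j : Fin 2) :
    (offDiag a b * Y) 1 j = b * Y 0 j := by
  simp [offDiag, Matrix.mul_apply, -Matrix.cons_mul]

theorem offDiag_mul_offDiag {a b a' b' : M} (h : a * b' = 1) (h' : b * a' = 1) :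
    offDiag a b * offDiag a' b' = 1 := by
  simp [offDiag, Matrix.one_fin_two, h, h']

/-- The signal operators of the alternating circuit: `u` in the even steps and `v` in the odd
steps, followed or preceded by the reflection `r`. -/
def signal (u v r : M) (n : ℕ) : Fin 2 → M :=
  ![r * (if n % 2 = 0 then u else v), (if n % 2 = 0 then u else v) * r]

/-- The walk operator `r * ũ`, where `ũ` has the off-diagonal blocks `v` and `u`. -/
def walk (u v r : M) : Matrix (Fin 2) (Fin 2) M := offDiag (r * v) (r * u)

/-- The inverse `ũ * r` of the walk operator. -/
def walkInv (u v r : M) : Matrix (Fin 2) (Fin 2) M := offDiag (v * r) (u * r)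

theorem walk_mul_walkInv {u v r : M} (huv : u * v = 1) (hvu : v * u = 1) (hr : r * r = 1) :
    walk u v r * walkInv u v r = 1 :=
  offDiag_mul_offDiag (by rw [mul_assoc, ← mul_assoc v, hvu, one_mul, hr])
    (by rw [mul_assoc, ← mul_assoc u, huv, one_mul, hr])

theorem walkInv_mul_walk {u v r : M} (huv : u * v = 1) (hvu : v * u = 1) (hr : r * r = 1) :
    walkInv u v r * walk u v r = 1 :=
  offDiag_mul_offDiag (by rw [mul_assoc, ← mul_assoc r, hr, one_mul, hvu])
    (by rw [mul_assoc, ← mul_assoc r, hr, one_mul, huv])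

/-- Each walk step, forward or backward, flips the doubling index. Starting from index `0`, the
steps meet `u` and `v` alternately, so a constant signal on the doubled space reproduces the
alternating one. -/
theorem qspColumn_walk_apply [Algebra ℂ M] (u v r : M) (A : ℕ → Matrix (Fin 2) (Fin 2) ℂ) (n : ℕ)
    (c i : Fin 2) :
    qspColumn A (fun _ => ![walk u v r, walkInv u v r]) n c i 0 =
      if (i : ℕ) = n % 2 then qspColumn A (signal u v r) n c else 0 := by
  unfold walk walkInv
  induction n generalizing c i with
  | zero => fin_cases i <;> simp [qspColumn]
  | succ n ih =>
    simp only [qspColumn, Fin.sum_univ_two, Matrix.add_apply, Matrix.smul_apply,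
      Matrix.cons_val_zero, Matrix.cons_val_one]
    rcases Nat.mod_two_eq_zero_or_one n with h | h
    · have h' : (n + 1) % 2 = 1 := by omega
      fin_cases i <;>
        simp [offDiag_mul_apply_zero, offDiag_mul_apply_one, ih, h, h', signal]
    · have h' : (n + 1) % 2 = 0 := by omega
      fin_cases i <;>
        simp [offDiag_mul_apply_zero, offDiag_mul_apply_one, ih, h, h', signal]

end Walk

/-- The signal `(z, w)` is `w * (z ^ 2, 1)`, as `w` is the inverse of `z`. One factor `w` is pulled
out of each of the `n` steps. -/
theorem qspColumn_eq_aeval {R : Type*} [Ring R] [Algebra ℂ R] {z w : R} (hzw : z * w = 1)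
    (hwz : w * z = 1) (A : ℕ → Matrix (Fin 2) (Fin 2) ℂ) (n : ℕ) (c : Fin 2) :
    qspColumn A (fun _ => ![z, w]) n c =
      w ^ n * aeval (z ^ 2) (qspColumn A (fun _ => ![(X : ℂ[X]), 1]) n c) := by
  have hc : Commute z w := by rw [Commute, SemiconjBy, hzw, hwz]
  induction n generalizing c with
  | zero => simp [qspColumn]
  | succ n ih =>
    have h1 : z * w ^ n = w ^ (n + 1) * z ^ 2 := by
      rw [(hc.pow_right n).eq, pow_succ, pow_two, mul_assoc, ← mul_assoc w z z, hwz, one_mul]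
    simp only [qspColumn, Fin.sum_univ_two, ih, Matrix.cons_val_zero, Matrix.cons_val_one,
      map_add, map_smul, map_mul, aeval_X, one_mul, mul_add, mul_smul_comm]
    rw [← mul_assoc z, h1, mul_assoc, ← mul_assoc w, ← pow_succ']

section Block

variable {K ι : Type*} [Fintype K] [DecidableEq K] [Fintype ι] [DecidableEq ι]

/-- The mean of the walk and its inverse is off-diagonal, and `J` intertwines each of its two blocks
with `H`. Each power moves one `H` past `J` and flips the index. -/
theorem mul_walk_pow_apply {u v r : Matrix K K ℂ} {J : Matrix ι K ℂ} {H : Matrix ι ι ℂ}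
    (hu : J * ((1 / 2 : ℂ) • (r * u + u * r)) = H * J)
    (hv : J * ((1 / 2 : ℂ) • (r * v + v * r)) = H * J) (k : ℕ) (i : Fin 2) :
    J * ((((1 / 2 : ℂ) • (walk u v r + walkInv u v r)) ^ k) i 0) =
      if (i : ℕ) = k % 2 then H ^ k * J else 0 := by
  have hW : (1 / 2 : ℂ) • (walk u v r + walkInv u v r) =
      offDiag ((1 / 2 : ℂ) • (r * v + v * r)) ((1 / 2 : ℂ) • (r * u + u * r)) := by
    ext1 i j
    fin_cases i <;> fin_cases j <;> simp [walk, walkInv, offDiag]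
  rw [hW]
  induction k generalizing i with
  | zero => fin_cases i <;> simp
  | succ k ih =>
    rw [pow_succ']
    have hi : i = 0 ∨ i = 1 := by omega
    rcases hi with rfl | rfl
    · rw [offDiag_mul_apply_zero, ← Matrix.mul_assoc, hv, Matrix.mul_assoc, ih]
      rcases Nat.mod_two_eq_zero_or_one k with h | h
      · simp [h, show (k + 1) % 2 = 1 by omega]
      · simp [h, show (k + 1) % 2 = 0 by omega, pow_succ', Matrix.mul_assoc]
    · rw [offDiag_mul_apply_one, ← Matrix.mul_assoc, hu, Matrix.mul_assoc, ih]
      rcases Nat.mod_two_eq_zero_or_one k with h | h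
      · simp [h, show (k + 1) % 2 = 1 by omega, pow_succ', Matrix.mul_assoc]
      · simp [h, show (k + 1) % 2 = 0 by omega]

/-- The transformation of a block-encoded matrix by an alternating circuit. -/
theorem mul_qspColumn_signal {u v r : Matrix K K ℂ} {J : Matrix ι K ℂ} {H : Matrix ι ι ℂ}
    (huv : u * v = 1) (hvu : v * u = 1) (hr : r * r = 1)
    (hu : J * ((1 / 2 : ℂ) • (r * u + u * r)) = H * J)
    (hv : J * ((1 / 2 : ℂ) • (r * v + v * r)) = H * J)
    {A : ℕ → Matrix (Fin 2) (Fin 2) ℂ} {n : ℕ} {F : ℂ[X]} (hd : F.natDegree ≤ n)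
    (hpar : ∀ k, k % 2 ≠ n % 2 → F.coeff k = 0)
    (hA : qspColumn A (fun _ => ![X, 1]) n 0 = laurentForm n F) :
    J * qspColumn A (signal u v r) n 0 = aeval H F * J := by
  -- Only the row of index `n % 2` is nonzero in the doubled column. The same parity selects the
  -- monomials that occur in `F`.
  have hlt : n % 2 < 2 := Nat.mod_lt _ (by norm_num)
  have h1 := qspColumn_walk_apply u v r A n 0 ⟨n % 2, hlt⟩
  rw [if_pos rfl, qspColumn_eq_aeval (walk_mul_walkInv huv hvu hr) (walkInv_mul_walk huv hvu hr),
    hA, aeval_laurentForm hd hpar (walk_mul_walkInv huv hvu hr) (walkInv_mul_walk huv hvu hr)] at h1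
  rw [← h1, aeval_eq_sum_range, aeval_eq_sum_range, Matrix.sum_apply, Matrix.mul_sum,
    Matrix.sum_mul]
  refine Finset.sum_congr rfl fun k _ => ?_
  rw [Matrix.smul_apply, Matrix.mul_smul, mul_walk_pow_apply hu hv, Matrix.smul_mul]
  by_cases hk : k % 2 = n % 2
  · rw [if_pos hk.symm]
  · rw [hpar k hk, zero_smul, zero_smul]

end Block

end HamSim

namespace HamSim

variable {ι : Type*} [Fintype ι] [DecidableEq ι] {w m : ℕ}

/-! ### Elementary properties of circuits -/

theorem controlled_apply (U : Matrix (Qubits m × ι) (Qubits m × ι) ℂ) (x y : Register w m ι) :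
    controlled w U x y = if x.1 = y.1 ∧ x.2.1 = y.2.1 then
      (if x.1 = 1 then U else 1) x.2.2 y.2.2 else 0 := by
  obtain ⟨b, v, k⟩ := x
  obtain ⟨b', v', k'⟩ := y
  simp only [controlled, Matrix.add_apply, Matrix.kroneckerMap_apply]
  rcases eq_or_ne v v' with rfl | h
  · fin_cases b <;> fin_cases b' <;> simp [Matrix.single]
  · fin_cases b <;> fin_cases b' <;> simp [h, Matrix.single]

theorem conjTranspose_controlled (U : Matrix (Qubits m × ι) (Qubits m × ι) ℂ) :
    (controlled w U)ᴴ = controlled w Uᴴ := by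
  ext x y
  rw [Matrix.conjTranspose_apply, controlled_apply, controlled_apply]
  by_cases h : x.1 = y.1 ∧ x.2.1 = y.2.1
  · rw [if_pos h, if_pos ⟨h.1.symm, h.2.symm⟩, h.1]
    split_ifs
    · rfl
    · rw [← Matrix.conjTranspose_apply, Matrix.conjTranspose_one]
  · rw [if_neg h, if_neg fun h' => h ⟨h'.1.symm, h'.2.symm⟩, star_zero]

theorem controlled_mul (U V : Matrix (Qubits m × ι) (Qubits m × ι) ℂ) :
    controlled w U * controlled w V = controlled w (U * V) := by
  simp only [controlled, add_mul, mul_add, ← Matrix.mul_kronecker_mul]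
  simp

theorem controlled_one :
    controlled w (1 : Matrix (Qubits m × ι) (Qubits m × ι) ℂ) = 1 := by
  ext x y
  obtain ⟨b, v, k⟩ := x
  obtain ⟨b', v', k'⟩ := y
  rw [controlled_apply, ite_self, Matrix.one_apply, Matrix.one_apply]
  by_cases h1 : b = b' <;> by_cases h2 : v = v' <;> simp [h1, h2]

theorem controlled_mem_unitaryGroup {U : Matrix (Qubits m × ι) (Qubits m × ι) ℂ}
    (hU : U ∈ Matrix.unitaryGroup (Qubits m × ι) ℂ) :
    controlled w U ∈ Matrix.unitaryGroup (Register w m ι) ℂ := by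
  rw [Matrix.mem_unitaryGroup_iff, Matrix.star_eq_conjTranspose, conjTranspose_controlled,
    controlled_mul, ← Matrix.star_eq_conjTranspose, Matrix.mem_unitaryGroup_iff.1 hU,
    controlled_one]

theorem Step.eval_mem_unitaryGroup {U : Matrix (Qubits m × ι) (Qubits m × ι) ℂ}
    (hU : U ∈ Matrix.unitaryGroup (Qubits m × ι) ℂ) (s : Step w m ι) :
    s.eval U ∈ Matrix.unitaryGroup (Register w m ι) ℂ := by
  cases s with
  | gate V => exact V.2
  | query => exact controlled_mem_unitaryGroup hU
  | queryInv => exact controlled_mem_unitaryGroup (Unitary.star_mem hU)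

theorem Circuit.eval_mem_unitaryGroup {U : Matrix (Qubits m × ι) (Qubits m × ι) ℂ}
    (hU : U ∈ Matrix.unitaryGroup (Qubits m × ι) ℂ) (C : Circuit w m ι) :
    Circuit.eval C U ∈ Matrix.unitaryGroup (Register w m ι) ℂ := by
  refine list_prod_mem fun x hx => ?_
  obtain ⟨s, _, rfl⟩ := List.mem_map.1 hx
  exact s.eval_mem_unitaryGroup hU

/-- The inverse of a step. -/
noncomputable def Step.inv : Step w m ι → Step w m ι
  | .gate V => .gate V⁻¹
  | .query => .queryInv
  | .queryInv => .query

theorem Step.eval_inv (U : Matrix (Qubits m × ι) (Qubits m × ι) ℂ) (s : Step w m ι) :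
    s.inv.eval U = (s.eval U)ᴴ := by
  cases s with
  | gate V => rfl
  | query => exact (conjTranspose_controlled U).symm
  | queryInv =>
    change controlled w U = (controlled w Uᴴ)ᴴ
    rw [conjTranspose_controlled, Matrix.conjTranspose_conjTranspose]

theorem Step.queries_inv (s : Step w m ι) : s.inv.queries = s.queries := by
  cases s <;> rfl

/-- The inverse of a circuit. -/
noncomputable def Circuit.inv (C : Circuit w m ι) : Circuit w m ι := (C.map Step.inv).reverse

theorem Circuit.eval_cons (U : Matrix (Qubits m × ι) (Qubits m × ι) ℂ) (s : Step w m ι)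
    (C : Circuit w m ι) : Circuit.eval (s :: C) U = s.eval U * Circuit.eval C U := by
  simp [Circuit.eval]

theorem Circuit.eval_append (U : Matrix (Qubits m × ι) (Qubits m × ι) ℂ) (C D : Circuit w m ι) :
    Circuit.eval (C ++ D) U = Circuit.eval C U * Circuit.eval D U := by
  simp [Circuit.eval]

theorem Circuit.queries_cons (s : Step w m ι) (C : Circuit w m ι) :
    Circuit.queries (s :: C) = s.queries + Circuit.queries C := by
  simp [Circuit.queries]

theorem Circuit.queries_append (C D : Circuit w m ι) :
    Circuit.queries (C ++ D) = Circuit.queries C + Circuit.queries D := by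
  simp [Circuit.queries]

theorem Circuit.eval_inv (U : Matrix (Qubits m × ι) (Qubits m × ι) ℂ) (C : Circuit w m ι) :
    Circuit.eval C.inv U = (Circuit.eval C U)ᴴ := by
  induction C with
  | nil => simp [Circuit.eval, Circuit.inv]
  | cons s C ih =>
    have : Circuit.inv (s :: C) = Circuit.inv C ++ [s.inv] := by simp [Circuit.inv]
    rw [this, Circuit.eval_append, ih, Circuit.eval_cons U s, Matrix.conjTranspose_mul,
      ← Step.eval_inv]
    simp [Circuit.eval]

theorem Circuit.queries_inv (C : Circuit w m ι) : C.inv.queries = C.queries := by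
  induction C with
  | nil => rfl
  | cons s C ih =>
    have : Circuit.inv (s :: C) = Circuit.inv C ++ [s.inv] := by simp [Circuit.inv]
    rw [this, Circuit.queries_append, ih, Circuit.queries_cons s, add_comm]
    simp [Circuit.queries, Step.queries_inv]

/-! ### Circuits with three control qubits -/

/-- The basis of the control qubits: the control of the queries, and two work qubits. -/
abbrev Control : Type := Fin 2 × Fin 2 × Fin 2

/-- The decomposition of the register into control qubits and the space of the queried unitary. -/
def registerEquiv (m : ℕ) (ι : Type*) : Register 2 m ι ≃ Control × (Qubits m × ι) where
  toFun x := ((x.1, x.2.1 0, x.2.1 1), x.2.2)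
  invFun y := (y.1.1, ![y.1.2.1, y.1.2.2], y.2)
  left_inv x := by
    obtain ⟨b, v, k⟩ := x
    have : ![v 0, v 1] = v := by ext i; fin_cases i <;> rfl
    simp [this]
  right_inv y := by simp

/-- The block of an operator at a pair of basis states of the control qubits. -/
def controlBlock (Y : Matrix (Control × (Qubits m × ι)) (Control × (Qubits m × ι)) ℂ)
    (ω ω' : Control) : Matrix (Qubits m × ι) (Qubits m × ι) ℂ :=
  Matrix.of fun k k' => Y (ω, k) (ω', k')

/-- The blocks of an operator on the register at the initial state of the control qubits. -/
def controlColumn (X : Matrix (Register 2 m ι) (Register 2 m ι) ℂ) (ω : Control) :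
    Matrix (Qubits m × ι) (Qubits m × ι) ℂ :=
  controlBlock (X.submatrix (registerEquiv m ι).symm (registerEquiv m ι).symm) ω 0

theorem controlColumn_mul
    (Y : Matrix (Control × (Qubits m × ι)) (Control × (Qubits m × ι)) ℂ)
    (X : Matrix (Register 2 m ι) (Register 2 m ι) ℂ) (ω : Control) :
    controlColumn (Y.submatrix (registerEquiv m ι) (registerEquiv m ι) * X) ω =
      ∑ ω', controlBlock Y ω ω' * controlColumn X ω' := by
  ext k k'
  rw [Matrix.sum_apply]
  simp only [controlColumn, controlBlock, Matrix.of_apply, Matrix.submatrix_apply,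
    Matrix.mul_apply]
  rw [← (registerEquiv m ι).symm.sum_comp, Fintype.sum_prod_type]
  simp

theorem submatrix_equiv_mem_unitaryGroup {α β : Type*} [Fintype α] [DecidableEq α] [Fintype β]
    [DecidableEq β] (e : α ≃ β) {Y : Matrix β β ℂ} (hY : Y ∈ Matrix.unitaryGroup β ℂ) :
    Y.submatrix e e ∈ Matrix.unitaryGroup α ℂ := by
  rw [Matrix.mem_unitaryGroup_iff, Matrix.star_eq_conjTranspose] at *
  rw [Matrix.conjTranspose_submatrix, Matrix.submatrix_mul_equiv, hY, Matrix.submatrix_one_equiv]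

/-- There is a circuit with `n` queries that takes the initial state `|0⟩` of the control qubits
to the states with components `Ξ U`. -/
def Reaches (n : ℕ) (Ξ : Matrix (Qubits m × ι) (Qubits m × ι) ℂ → Control →
    Matrix (Qubits m × ι) (Qubits m × ι) ℂ) : Prop :=
  ∃ C : Circuit 2 m ι, Circuit.queries C = n ∧ ∀ U ω, controlColumn (Circuit.eval C U) ω = Ξ U ω

variable {n : ℕ} {Ξ : Matrix (Qubits m × ι) (Qubits m × ι) ℂ → Control →
    Matrix (Qubits m × ι) (Qubits m × ι) ℂ}

theorem reaches_zero :
    Reaches 0 fun (_ : Matrix (Qubits m × ι) (Qubits m × ι) ℂ) ω => if ω = 0 then 1 else 0 := by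
  refine ⟨[], rfl, fun U ω => ?_⟩
  ext k k'
  have : Circuit.eval ([] : Circuit 2 m ι) U = 1 := rfl
  rw [this, controlColumn, Matrix.submatrix_one_equiv, controlBlock, Matrix.of_apply,
    Matrix.one_apply]
  by_cases h : ω = 0
  · simp [h, Matrix.one_apply]
  · simp [h]

theorem Reaches.step (h : Reaches n Ξ) (s : Step 2 m ι)
    {Y : Matrix (Qubits m × ι) (Qubits m × ι) ℂ →
      Matrix (Control × (Qubits m × ι)) (Control × (Qubits m × ι)) ℂ}
    (hY : ∀ U, s.eval U = (Y U).submatrix (registerEquiv m ι) (registerEquiv m ι))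
    {Ξ' : Matrix (Qubits m × ι) (Qubits m × ι) ℂ → Control →
      Matrix (Qubits m × ι) (Qubits m × ι) ℂ}
    (hΞ : ∀ U ω, Ξ' U ω = ∑ ω', controlBlock (Y U) ω ω' * Ξ U ω') :
    Reaches (n + s.queries) Ξ' := by
  obtain ⟨C, rfl, hC⟩ := h
  refine ⟨s :: C, by rw [Circuit.queries_cons, add_comm], fun U ω => ?_⟩
  rw [Circuit.eval_cons, hY, controlColumn_mul, hΞ]
  simp only [hC]

theorem Reaches.gate (h : Reaches n Ξ) {A : Matrix Control Control ℂ}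
    (hA : A ∈ Matrix.unitaryGroup Control ℂ) :
    Reaches n fun U ω => ∑ ω', A ω ω' • Ξ U ω' := by
  have hY : A ⊗ₖ (1 : Matrix (Qubits m × ι) (Qubits m × ι) ℂ) ∈
      Matrix.unitaryGroup (Control × (Qubits m × ι)) ℂ :=
    Matrix.kronecker_mem_unitary hA (one_mem _)
  refine h.step (.gate ⟨_, submatrix_equiv_mem_unitaryGroup (registerEquiv m ι) hY⟩)
    (fun U => rfl) fun U ω => Finset.sum_congr rfl fun ω' _ => ?_
  rw [show controlBlock (A ⊗ₖ (1 : Matrix (Qubits m × ι) (Qubits m × ι) ℂ)) ω ω' = A ω ω' • 1 by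
    ext; simp [controlBlock], smul_mul_assoc, one_mul]

theorem Reaches.perm (h : Reaches n Ξ) (σ : Equiv.Perm Control) :
    Reaches n fun U ω => Ξ U (σ ω) := by
  have hA : (1 : Matrix Control Control ℂ).submatrix σ id ∈ Matrix.unitaryGroup Control ℂ := by
    rw [Matrix.mem_unitaryGroup_iff, Matrix.star_eq_conjTranspose,
      Matrix.conjTranspose_submatrix, Matrix.conjTranspose_one,
      ← Matrix.submatrix_mul _ _ _ _ _ Function.bijective_id, mul_one,
      Matrix.submatrix_one_equiv]
  convert h.gate hA using 3 with U ω
  simp [Matrix.one_apply]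

/-- The reflection about the initial state of the `m` qubits. -/
def reflection (m : ℕ) (ι : Type*) [DecidableEq ι] : Matrix (Qubits m × ι) (Qubits m × ι) ℂ :=
  Matrix.diagonal fun k => if k.1 = 0 then 1 else -1

theorem sum_ite_mul {K : Type*} [Fintype K] (B : Control → Matrix K K ℂ)
    (Ξ : Control → Matrix K K ℂ) (ω : Control) :
    ∑ ω', (if ω = ω' then B ω else 0) * Ξ ω' = B ω * Ξ ω := by
  simp [ite_mul]

theorem Reaches.reflect (h : Reaches n Ξ) (T : Control → Prop) [DecidablePred T] :
    Reaches n fun U ω => (if T ω then reflection m ι else 1) * Ξ U ω := by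
  set d : Control × (Qubits m × ι) → ℂ := fun x => if T x.1 then (if x.2.1 = 0 then 1 else -1)
    else 1 with hd
  have hY : Matrix.diagonal d ∈ Matrix.unitaryGroup (Control × (Qubits m × ι)) ℂ := by
    rw [Matrix.mem_unitaryGroup_iff, Matrix.star_eq_conjTranspose,
      Matrix.diagonal_conjTranspose, Matrix.diagonal_mul_diagonal, ← Matrix.diagonal_one]
    congr 1
    ext x
    simp only [hd, Pi.star_apply]
    split_ifs <;> simp
  refine h.step (.gate ⟨_, submatrix_equiv_mem_unitaryGroup (registerEquiv m ι) hY⟩)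
    (fun U => rfl) fun U ω => ?_
  rw [← sum_ite_mul (fun ω => if T ω then reflection m ι else 1)]
  refine Finset.sum_congr rfl fun ω' _ => ?_
  congr 1
  ext k k'
  by_cases hω : ω = ω'
  · subst hω
    by_cases hT : T ω <;> by_cases hk : k = k' <;>
      simp [controlBlock, reflection, hd, hT, hk, Matrix.diagonal_apply, Matrix.one_apply]
  · simp [controlBlock, hω]

theorem controlled_eq_submatrix (U : Matrix (Qubits m × ι) (Qubits m × ι) ℂ) :
    controlled 2 U = (Matrix.of fun x y : Control × (Qubits m × ι) =>
      (if x.1 = y.1 then (if x.1.1 = 1 then U else 1) else 0) x.2 y.2).submatrix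
        (registerEquiv m ι) (registerEquiv m ι) := by
  ext x y
  rw [controlled_apply, Matrix.submatrix_apply, Matrix.of_apply]
  have : (x.1 = y.1 ∧ x.2.1 = y.2.1) ↔ (registerEquiv m ι x).1 = (registerEquiv m ι y).1 := by
    simp [registerEquiv, funext_iff, Fin.forall_fin_two]
  by_cases h : x.1 = y.1 ∧ x.2.1 = y.2.1
  · rw [if_pos h, if_pos (this.1 h)]; rfl
  · rw [if_neg h, if_neg (fun h' => h (this.2 h'))]; rfl

theorem Reaches.query (h : Reaches n Ξ) (k : ℕ) :
    Reaches (n + 1) fun U ω =>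
      (if ω.1 = 1 then (if k % 2 = 0 then U else Uᴴ) else 1) * Ξ U ω := by
  have hb : ∀ (V : Matrix (Qubits m × ι) (Qubits m × ι) ℂ) (ω ω' : Control),
      controlBlock (Matrix.of fun x y : Control × (Qubits m × ι) =>
        (if x.1 = y.1 then (if x.1.1 = 1 then V else 1) else 0) x.2 y.2) ω ω' =
          if ω = ω' then (if ω.1 = 1 then V else 1) else 0 := fun V ω ω' => rfl
  by_cases hk : k % 2 = 0
  · refine h.step .query (fun U => controlled_eq_submatrix U) fun U ω => ?_
    simp only [hb, hk, if_true]
    rw [sum_ite_mul (fun ω => if ω.1 = 1 then U else 1)]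
  · refine h.step .queryInv (fun U => controlled_eq_submatrix Uᴴ) fun U ω => ?_
    simp only [hb, hk, if_false]
    rw [sum_ite_mul (fun ω => if ω.1 = 1 then Uᴴ else 1)]

end HamSim

namespace HamSim

open Polynomial

variable {ι : Type*} [Fintype ι] [DecidableEq ι] {m : ℕ}

/-! ### Gates on the control qubits -/

/-- The gate that applies `B q` to the last control qubit if the middle one is in the state `q`. -/
noncomputable def selectGate (B : Fin 2 → Matrix (Fin 2) (Fin 2) ℂ) : Matrix Control Control ℂ :=
  (1 : Matrix (Fin 2) (Fin 2) ℂ) ⊗ₖ (Matrix.blockDiagonal B).submatrix Prod.swap Prod.swap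

theorem selectGate_mem {B : Fin 2 → Matrix (Fin 2) (Fin 2) ℂ}
    (hB : ∀ q, B q ∈ Matrix.unitaryGroup (Fin 2) ℂ) :
    selectGate B ∈ Matrix.unitaryGroup Control ℂ := by
  refine Matrix.kronecker_mem_unitary (one_mem _)
    (submatrix_equiv_mem_unitaryGroup (Equiv.prodComm _ _) ?_)
  rw [Matrix.mem_unitaryGroup_iff, Matrix.star_eq_conjTranspose,
    Matrix.blockDiagonal_conjTranspose, ← Matrix.blockDiagonal_mul, ← Matrix.blockDiagonal_one]
  congr 1
  ext1 q
  exact Matrix.mem_unitaryGroup_iff.1 (hB q)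

theorem sum_selectGate_smul {R : Type*} [AddCommGroup R] [Module ℂ R]
    (B : Fin 2 → Matrix (Fin 2) (Fin 2) ℂ) (f : Control → R) (ω : Control) :
    ∑ ω', selectGate B ω ω' • f ω' = ∑ c, B ω.2.1 ω.2.2 c • f (ω.1, ω.2.1, c) := by
  obtain ⟨b, q, c⟩ := ω
  simp only [Fintype.sum_prod_type, Fin.sum_univ_two, selectGate, Matrix.kroneckerMap_apply,
    Matrix.submatrix_apply, Prod.swap, Matrix.blockDiagonal_apply]
  rcases (by omega : b = 0 ∨ b = 1) with rfl | rfl <;>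
  rcases (by omega : q = 0 ∨ q = 1) with rfl | rfl <;> simp

/-- The gate that applies `A` to the middle control qubit. -/
noncomputable def middleGate (A : Matrix (Fin 2) (Fin 2) ℂ) : Matrix Control Control ℂ :=
  (1 : Matrix (Fin 2) (Fin 2) ℂ) ⊗ₖ (A ⊗ₖ (1 : Matrix (Fin 2) (Fin 2) ℂ))

theorem middleGate_mem {A : Matrix (Fin 2) (Fin 2) ℂ} (hA : A ∈ Matrix.unitaryGroup (Fin 2) ℂ) :
    middleGate A ∈ Matrix.unitaryGroup Control ℂ :=
  Matrix.kronecker_mem_unitary (one_mem _) (Matrix.kronecker_mem_unitary hA (one_mem _))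

theorem sum_middleGate_smul {R : Type*} [AddCommGroup R] [Module ℂ R]
    (A : Matrix (Fin 2) (Fin 2) ℂ) (f : Control → R) (ω : Control) :
    ∑ ω', middleGate A ω ω' • f ω' = ∑ q, A ω.2.1 q • f (ω.1, q, ω.2.2) := by
  obtain ⟨b, q, c⟩ := ω
  simp only [Fintype.sum_prod_type, Fin.sum_univ_two, middleGate, Matrix.kroneckerMap_apply]
  rcases (by omega : b = 0 ∨ b = 1) with rfl | rfl <;>
  rcases (by omega : c = 0 ∨ c = 1) with rfl | rfl <;> simp

theorem toggle_involutive (T : Fin 2 → Prop) [DecidablePred T] :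
    Function.Involutive fun ω : Control => (if T ω.2.1 then ω.1 else 1 - ω.1, ω.2) := by
  rintro ⟨b, q, c⟩
  by_cases h : T q <;> simp [h]

/-- The permutation that flips the control of the queries unless the middle qubit satisfies `T`. -/
def toggle (T : Fin 2 → Prop) [DecidablePred T] : Equiv.Perm Control :=
  (toggle_involutive T).toPerm

theorem toggle_apply (T : Fin 2 → Prop) [DecidablePred T] (ω : Control) :
    toggle T ω = (if T ω.2.1 then ω.1 else 1 - ω.1, ω.2) := rfl

/-! ### The alternating circuit -/

/-- States whose query control is active. -/
def onActive {M : Type*} [Zero M] (ξ : Fin 2 → Fin 2 → M) (ω : Control) : M :=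
  if ω.1 = 1 then ξ ω.2.1 ω.2.2 else 0

variable {n : ℕ} {ξ : Matrix (Qubits m × ι) (Qubits m × ι) ℂ → Fin 2 → Fin 2 →
    Matrix (Qubits m × ι) (Qubits m × ι) ℂ}

/-- One query extends the product in the branches `q` satisfying `T` and leaves the others alone.
This is how products of different lengths share one circuit. -/
theorem Reaches.advance (h : Reaches n fun U => onActive (ξ U)) (k : ℕ) (T : Fin 2 → Prop)
    [DecidablePred T] {B : Fin 2 → Matrix (Fin 2) (Fin 2) ℂ}
    (hB : ∀ q, B q ∈ Matrix.unitaryGroup (Fin 2) ℂ) :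
    Reaches (n + 1) fun U => onActive fun q c => if T q then
      ∑ c', B q c c' • (signal U Uᴴ (reflection m ι) k c' * ξ U q c') else ξ U q c := by
  have hB' : ∀ q, (if T q then B q else 1) ∈ Matrix.unitaryGroup (Fin 2) ℂ := fun q => by
    split_ifs
    · exact hB q
    · exact one_mem _
  -- The toggle switches the query control off in the idle branches. The reflection precedes the
  -- query when `c = 1` and follows it when `c = 0`, as `signal` demands; the last toggle restores
  -- the control.
  have h' := (((((h.perm (toggle T)).reflect (fun ω => ω.1 = 1 ∧ ω.2.2 = 1)).query k).reflect
    (fun ω => ω.1 = 1 ∧ ω.2.2 = 0)).gate (selectGate_mem hB')).perm (toggle T)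
  convert h' using 3 with U ω
  obtain ⟨b, q, c⟩ := ω
  rw [sum_selectGate_smul]
  by_cases hT : T q
  · by_cases hb : b = 1
    · simp [toggle_apply, onActive, hT, hb, signal, mul_assoc]
    · simp [toggle_apply, onActive, hT, hb]
  · by_cases hb : b = 1
    · subst hb
      rcases (by omega : c = 0 ∨ c = 1) with rfl | rfl <;>
        simp [toggle_apply, onActive, hT, Matrix.one_apply]
    · obtain rfl : b = 0 := by omega
      simp [toggle_apply, onActive, hT]

variable {A : Fin 2 → ℕ → Matrix (Fin 2) (Fin 2) ℂ}

theorem reaches_prepare (hA : ∀ q k, A q k ∈ Matrix.unitaryGroup (Fin 2) ℂ) {s : ℂ}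
    (hs : star s * s + star s * s = 1) :
    Reaches 0 fun (U : Matrix (Qubits m × ι) (Qubits m × ι) ℂ) => onActive fun q c =>
      s • qspColumn (A q) (signal U Uᴴ (reflection m ι)) 0 c := by
  -- The middle qubit is put in superposition, the toggle with the predicate `False` turns the query
  -- control on, and the initial matrix of each branch is applied.
  have h := (((reaches_zero (m := m) (ι := ι)).gate (middleGate_mem (columnUnitary_mem hs))).perm
    (toggle fun _ => False)).gate (selectGate_mem fun q => hA q 0)
  convert h using 3 with U ω
  obtain ⟨b, q, c⟩ := ω
  simp only [sum_selectGate_smul, sum_middleGate_smul]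
  rcases (by omega : b = 0 ∨ b = 1) with rfl | rfl <;>
  rcases (by omega : q = 0 ∨ q = 1) with rfl | rfl <;>
    simp [onActive, toggle_apply, columnUnitary, qspColumn, smul_smul, mul_comm]

theorem reaches_qspColumn (hA : ∀ q k, A q k ∈ Matrix.unitaryGroup (Fin 2) ℂ) {s : ℂ}
    (hs : star s * s + star s * s = 1) (n : ℕ) :
    Reaches n fun (U : Matrix (Qubits m × ι) (Qubits m × ι) ℂ) => onActive fun q c =>
      s • qspColumn (A q) (signal U Uᴴ (reflection m ι)) n c := by
  induction n with
  | zero => exact reaches_prepare hA hs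
  | succ n ih =>
    convert ih.advance n (fun _ => True) (fun q => hA q (n + 1)) using 5 with U q c
    simp [qspColumn, smul_comm s]

/-- A circuit whose initial block is the mean of two alternating products of lengths `n + 1` and
`n`. -/
theorem exists_circuit_mean (hA : ∀ q k, A q k ∈ Matrix.unitaryGroup (Fin 2) ℂ) (n : ℕ) :
    ∃ C : Circuit 2 m ι, Circuit.queries C = n + 1 ∧ ∀ U,
      controlColumn (Circuit.eval C U) 0 = (1 / 2 : ℂ) •
        (qspColumn (A 0) (signal U Uᴴ (reflection m ι)) (n + 1) 0 +
          qspColumn (A 1) (signal U Uᴴ (reflection m ι)) n 0) := by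
  obtain ⟨s, hs⟩ : ∃ s : ℝ, s * s = 1 / 2 :=
    ⟨Real.sqrt (1 / 2), Real.mul_self_sqrt (by norm_num)⟩
  have hsc : (s : ℂ) * s = 1 / 2 := by rw [← Complex.ofReal_mul, hs]; norm_num
  have hss : star (s : ℂ) = s := Complex.conj_ofReal s
  have hs1 : star (s : ℂ) * s + star (s : ℂ) * s = 1 := by rw [hss, hsc]; norm_num
  -- Both branches run for `n` queries, then the branch `q = 0` alone for one more. Switching the
  -- control off and undoing the superposition adds the branches with weight `s * s = 1 / 2`.
  obtain ⟨C, hC, hcol⟩ := (((reaches_qspColumn (m := m) (ι := ι) hA hs1 n).advance n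
    (fun q => q = 0) (fun q => hA q (n + 1))).perm (toggle fun _ => False)).gate
      (middleGate_mem (Unitary.star_mem (columnUnitary_mem hs1)))
  refine ⟨C, hC, fun U => ?_⟩
  refine (hcol U 0).trans ((sum_middleGate_smul _ _ _).trans ?_)
  simp only [Fin.sum_univ_two, toggle_apply, onActive, Matrix.star_apply, columnUnitary, qspColumn,
    smul_add, mul_smul_comm, smul_smul]
  simp [smul_smul, hsc, hss, mul_comm _ (s : ℂ), ← mul_assoc]
  rw [hs, ← Complex.coe_smul]
  norm_num

end HamSim

namespace HamSim

open Polynomial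

/-! ### Block-encodings -/

section BasisIsometry

variable {ι κ : Type*} [Fintype ι] [DecidableEq ι] [Fintype κ] [DecidableEq κ]

/-- The isometry that maps the basis vector `i` to the basis vector `f i`. -/
def basisIsometry (f : ι → κ) : Matrix κ ι ℂ := (1 : Matrix κ κ ℂ).submatrix id f

theorem conjTranspose_basisIsometry_mul_mul (f : ι → κ) (X : Matrix κ κ ℂ) :
    (basisIsometry f)ᴴ * X * basisIsometry f = X.submatrix f f := by
  ext i j
  simp [basisIsometry, Matrix.mul_apply, Matrix.one_apply]

theorem conjTranspose_basisIsometry_mul_self {f : ι → κ} (hf : f.Injective) :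
    (basisIsometry f)ᴴ * basisIsometry f = 1 := by
  have := conjTranspose_basisIsometry_mul_mul f 1
  rw [Matrix.mul_one] at this
  rw [this, Matrix.submatrix_one f hf]

/-- The reflection about the range of a basis isometry. -/
def rangeReflection (f : ι → κ) : Matrix κ κ ℂ :=
  (2 : ℂ) • (basisIsometry f * (basisIsometry f)ᴴ) - 1

theorem conjTranspose_basisIsometry_mul_rangeReflection {f : ι → κ} (hf : f.Injective) :
    (basisIsometry f)ᴴ * rangeReflection f = (basisIsometry f)ᴴ := by
  rw [rangeReflection, Matrix.mul_sub, Matrix.mul_smul, ← Matrix.mul_assoc,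
    conjTranspose_basisIsometry_mul_self hf, Matrix.one_mul, Matrix.mul_one, two_smul,
    add_sub_cancel_right]

theorem rangeReflection_mul_self {f : ι → κ} (hf : f.Injective) :
    rangeReflection f * rangeReflection f = 1 := by
  nth_rewrite 1 [rangeReflection]
  rw [sub_mul, smul_mul_assoc, Matrix.mul_assoc,
    conjTranspose_basisIsometry_mul_rangeReflection hf, one_mul, rangeReflection, sub_sub_cancel]

theorem conjTranspose_rangeReflection (f : ι → κ) :
    (rangeReflection f)ᴴ = rangeReflection f := by
  simp [rangeReflection, Matrix.conjTranspose_sub, Matrix.conjTranspose_smul]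

theorem rangeReflection_mem {f : ι → κ} (hf : f.Injective) :
    rangeReflection f ∈ Matrix.unitaryGroup κ ℂ := by
  rw [Matrix.mem_unitaryGroup_iff, Matrix.star_eq_conjTranspose, conjTranspose_rangeReflection,
    rangeReflection_mul_self hf]

/-- With `J` the adjoint of the isometry and `R` the reflection, `J R = J` and `R + 1` is twice the
range projection. The left side thus collapses to `J U` followed by that projection. -/
theorem conjTranspose_basisIsometry_mul_anticommutator {f : ι → κ} (hf : f.Injective)
    {U : Matrix κ κ ℂ} {H : Matrix ι ι ℂ} (hU : U.submatrix f f = H) :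
    (basisIsometry f)ᴴ * ((1 / 2 : ℂ) • (rangeReflection f * U + U * rangeReflection f)) =
      H * (basisIsometry f)ᴴ := by
  rw [Matrix.mul_smul, Matrix.mul_add, ← Matrix.mul_assoc,
    conjTranspose_basisIsometry_mul_rangeReflection hf, rangeReflection, Matrix.mul_sub,
    Matrix.mul_sub, Matrix.mul_one, add_sub_cancel, Matrix.mul_smul, Matrix.mul_smul, smul_smul,
    ← Matrix.mul_assoc, ← Matrix.mul_assoc, conjTranspose_basisIsometry_mul_mul, hU]
  norm_num

/-- Oblivious amplitude amplification. -/
theorem submatrix_amplification {f : ι → κ} (hf : f.Injective) {W : Matrix κ κ ℂ}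
    (hW : W ∈ Matrix.unitaryGroup κ ℂ) :
    (W * (rangeReflection f * (Wᴴ * (-rangeReflection f * W)))).submatrix f f =
      (3 : ℂ) • W.submatrix f f -
        (4 : ℂ) • (W.submatrix f f * (W.submatrix f f)ᴴ * W.submatrix f f) := by
  have h1 : W * Wᴴ = 1 := Matrix.mem_unitaryGroup_iff.1 hW
  have h2 : Wᴴ * W = 1 := Matrix.mem_unitaryGroup_iff'.1 hW
  simp only [← conjTranspose_basisIsometry_mul_mul]
  have hJ := conjTranspose_basisIsometry_mul_self hf
  set J := basisIsometry f with hJdef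
  -- Expanding both reflections and cancelling `W` against its adjoint leaves two terms linear in
  -- the range projection, one bare `W`, and one cubic term. Compression to the range gives `2 + 2 -
  -- 1 = 3` copies of the block.
  have hexp : W * (rangeReflection f * (Wᴴ * (-rangeReflection f * W))) =
      (2 : ℂ) • (J * Jᴴ * W) + (2 : ℂ) • (W * J * Jᴴ) - W -
        (4 : ℂ) • (W * J * (Jᴴ * Wᴴ * J) * Jᴴ * W) := by
    have : W * (rangeReflection f * (Wᴴ * (-rangeReflection f * W))) =
        (2 : ℂ) • ((W * Wᴴ) * (J * Jᴴ * W)) + (2 : ℂ) • (W * J * Jᴴ * (Wᴴ * W)) -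
          (W * Wᴴ) * W - (4 : ℂ) • (W * J * (Jᴴ * Wᴴ * J) * Jᴴ * W) := by
      simp only [rangeReflection, ← hJdef, Matrix.neg_mul, Matrix.mul_neg, Matrix.sub_mul,
        Matrix.mul_sub, Matrix.smul_mul, Matrix.mul_smul, Matrix.one_mul, Matrix.mul_assoc,
        smul_sub, smul_smul]
      norm_num
      abel
    rw [this, h1, h2, one_mul, one_mul, mul_one]
  rw [hexp]
  have e1 : Jᴴ * (J * Jᴴ * W) * J = Jᴴ * W * J := by
    rw [← Matrix.mul_assoc, ← Matrix.mul_assoc, hJ, Matrix.one_mul]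
  have e2 : Jᴴ * (W * J * Jᴴ) * J = Jᴴ * W * J := by
    simp only [Matrix.mul_assoc, hJ, Matrix.mul_one]
  simp only [Matrix.mul_sub, Matrix.mul_add, Matrix.sub_mul, Matrix.add_mul, Matrix.mul_smul,
    Matrix.smul_mul, e1, e2]
  have e3 : Jᴴ * (W * J * (Jᴴ * Wᴴ * J) * Jᴴ * W) * J =
      Jᴴ * W * J * (Jᴴ * W * J)ᴴ * (Jᴴ * W * J) := by
    simp only [Matrix.conjTranspose_mul, Matrix.conjTranspose_conjTranspose, Matrix.mul_assoc]
  rw [e3, show (3 : ℂ) = 2 + 2 - 1 by norm_num, sub_smul, add_smul, one_smul]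

end BasisIsometry

variable {ι : Type*} [Fintype ι] [DecidableEq ι] {w m : ℕ}

/-- The embedding of the system into the register, with all qubits in the state `0`. -/
def systemEmbedding (w m : ℕ) (ι : Type*) (i : ι) : Register w m ι := (0, 0, 0, i)

theorem systemEmbedding_injective : (systemEmbedding w m ι).Injective := fun i j h => by
  simpa [systemEmbedding] using h

theorem reflection_eq :
    reflection m ι = rangeReflection (fun i : ι => ((0 : Qubits m), i)) := by
  ext ⟨a, i⟩ ⟨b, j⟩
  simp only [reflection, rangeReflection, basisIsometry, Matrix.diagonal_apply, Matrix.sub_apply,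
    Matrix.smul_apply, Matrix.mul_apply, Matrix.conjTranspose_apply, Matrix.submatrix_apply,
    Matrix.one_apply, id, Prod.mk.injEq]
  by_cases ha : a = 0 <;> by_cases hb : b = 0 <;> by_cases hij : i = j <;>
    simp [ha, hb, hij, eq_comm]
  · norm_num
  · split_ifs <;> simp

theorem IsBlockEncoding.submatrix_eq {U : Matrix (Qubits m × ι) (Qubits m × ι) ℂ}
    {H : Matrix ι ι ℂ} (h : IsBlockEncoding U H) :
    U.submatrix (fun i : ι => ((0 : Qubits m), i)) (fun i : ι => ((0 : Qubits m), i)) = H := by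
  ext i j
  exact h.block i j

/-- A circuit that block-encodes the mean of two polynomials of opposite parity. -/
theorem exists_circuit_block {n : ℕ} {F G : ℂ[X]} (hFd : F.natDegree ≤ n + 1)
    (hFp : ∀ k, k % 2 ≠ (n + 1) % 2 → F.coeff k = 0)
    (hF : ∀ x : ℝ, |x| ≤ 1 → ‖F.eval (x : ℂ)‖ < 1) (hGd : G.natDegree ≤ n)
    (hGp : ∀ k, k % 2 ≠ n % 2 → G.coeff k = 0)
    (hG : ∀ x : ℝ, |x| ≤ 1 → ‖G.eval (x : ℂ)‖ < 1) :
    ∃ C : Circuit 2 m ι, Circuit.queries C = n + 1 ∧ ∀ H U, H.IsHermitian → IsBlockEncoding U H →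
      (Circuit.eval C U).submatrix (systemEmbedding 2 m ι) (systemEmbedding 2 m ι) =
        (1 / 2 : ℂ) • (aeval H F + aeval H G) := by
  obtain ⟨A, hA, hAF⟩ := exists_qspColumn_apply_zero_eq (natDegree_laurentForm_le (n + 1) F)
    fun y hy => norm_eval_laurentForm_lt_one hFd hFp hF hy
  obtain ⟨B, hB, hBG⟩ := exists_qspColumn_apply_zero_eq (natDegree_laurentForm_le n G)
    fun y hy => norm_eval_laurentForm_lt_one hGd hGp hG hy
  obtain ⟨C, hC, hcol⟩ := exists_circuit_mean (m := m) (ι := ι) (A := ![A, B])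
    (fun q k => by fin_cases q; exacts [hA k, hB k]) n
  refine ⟨C, hC, fun H U hH hU => ?_⟩
  set f : ι → Qubits m × ι := fun i => (0, i) with hf
  have hfi : f.Injective := fun i j h => by simpa [hf] using h
  have hr : reflection m ι * reflection m ι = 1 := by
    rw [reflection_eq, rangeReflection_mul_self hfi]
  have huv : U * Uᴴ = 1 := Matrix.mem_unitaryGroup_iff.1 hU.unitary
  have hvu : Uᴴ * U = 1 := Matrix.mem_unitaryGroup_iff'.1 hU.unitary
  have hu := conjTranspose_basisIsometry_mul_anticommutator hfi hU.submatrix_eq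
  -- Hermiticity of `H` enters here: the adjoint of `U` encodes the same matrix.
  have hv := conjTranspose_basisIsometry_mul_anticommutator hfi (U := Uᴴ) (H := H) (by
    rw [← Matrix.conjTranspose_submatrix, hU.submatrix_eq, hH.eq])
  rw [← reflection_eq] at hu hv
  have h0 : (Circuit.eval C U).submatrix (systemEmbedding 2 m ι) (systemEmbedding 2 m ι) =
      (controlColumn (Circuit.eval C U) 0).submatrix f f := by
    have he : ∀ i : ι, (registerEquiv m ι).symm (0, f i) = systemEmbedding 2 m ι i := by
      intro i
      have : (![0, 0] : Qubits 2) = 0 := by ext k; fin_cases k <;> rfl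
      simp [registerEquiv, systemEmbedding, hf, this]
    ext i j
    simp only [controlColumn, controlBlock, Matrix.submatrix_apply, Matrix.of_apply, he]
  rw [h0, hcol, ← conjTranspose_basisIsometry_mul_mul, Matrix.mul_smul, Matrix.mul_add]
  simp only [Matrix.cons_val_zero, Matrix.cons_val_one]
  rw [mul_qspColumn_signal huv hvu hr hu hv hFd hFp hAF,
    mul_qspColumn_signal huv hvu hr hu hv hGd hGp hBG, ← Matrix.add_mul, Matrix.smul_mul,
    Matrix.mul_assoc, conjTranspose_basisIsometry_mul_self hfi, Matrix.mul_one]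

/-- The amplified circuit. -/
theorem exists_circuit_amplified (C : Circuit w m ι) :
    ∃ D : Circuit w m ι, Circuit.queries D = 3 * Circuit.queries C ∧
      ∀ U ∈ Matrix.unitaryGroup (Qubits m × ι) ℂ, ∀ B,
        (Circuit.eval C U).submatrix (systemEmbedding w m ι) (systemEmbedding w m ι) = B →
        (Circuit.eval D U).submatrix (systemEmbedding w m ι) (systemEmbedding w m ι) =
          (3 : ℂ) • B - (4 : ℂ) • (B * Bᴴ * B) := by
  have hinj := systemEmbedding_injective (w := w) (m := m) (ι := ι)
  have hneg : -rangeReflection (systemEmbedding w m ι) ∈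
      Matrix.unitaryGroup (Register w m ι) ℂ := by
    rw [Matrix.mem_unitaryGroup_iff, Matrix.star_eq_conjTranspose, Matrix.conjTranspose_neg,
      conjTranspose_rangeReflection, neg_mul_neg, rangeReflection_mul_self hinj]
  refine ⟨C ++ Step.gate ⟨_, rangeReflection_mem hinj⟩ :: (C.inv ++ Step.gate ⟨_, hneg⟩ :: C),
    ?_, fun U hU B hB => ?_⟩
  · simp only [Circuit.queries_append, Circuit.queries_cons, Circuit.queries_inv, Step.queries]
    ring
  · rw [← hB, ← submatrix_amplification hinj (Circuit.eval_mem_unitaryGroup hU C)]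
    simp only [Circuit.eval_append, Circuit.eval_cons, Circuit.eval_inv, Step.eval]

end HamSim

/-! ### Operator norm and trace norm -/

namespace HamSim

section Norms

open scoped Matrix.Norms.L2Operator

variable {κ ι : Type*} [Fintype κ] [DecidableEq κ] [Fintype ι] [DecidableEq ι]

theorem exists_unitary_diagonal {A : Matrix κ κ ℂ} (hA : A.IsHermitian) :
    ∃ Q ∈ Matrix.unitaryGroup κ ℂ,
      A = Q * Matrix.diagonal (fun i => (hA.eigenvalues i : ℂ)) * Qᴴ :=
  ⟨hA.eigenvectorUnitary, hA.eigenvectorUnitary.2, by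
    conv_lhs => rw [hA.spectral_theorem, Unitary.conjStarAlgAut_apply]
    rfl⟩

theorem norm_le_one_of_conjTranspose_mul_self {J : Matrix κ ι ℂ} (h : Jᴴ * J = 1) : ‖J‖ ≤ 1 := by
  have h1 : ‖(1 : Matrix ι ι ℂ)‖ = ‖(1 : Matrix ι ι ℂ)‖ * ‖(1 : Matrix ι ι ℂ)‖ := by
    have := Matrix.l2_opNorm_conjTranspose_mul_self (1 : Matrix ι ι ℂ)
    rwa [Matrix.conjTranspose_one, one_mul] at this
  have h2 := Matrix.l2_opNorm_conjTranspose_mul_self J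
  rw [h] at h2
  have h3 : ‖(1 : Matrix ι ι ℂ)‖ ≤ 1 := by
    nlinarith [norm_nonneg (1 : Matrix ι ι ℂ), sq_nonneg (‖(1 : Matrix ι ι ℂ)‖ - 1)]
  nlinarith [norm_nonneg J]

theorem norm_le_one_of_mem_unitaryGroup {Q : Matrix κ κ ℂ} (hQ : Q ∈ Matrix.unitaryGroup κ ℂ) :
    ‖Q‖ ≤ 1 :=
  norm_le_one_of_conjTranspose_mul_self (Matrix.mem_unitaryGroup_iff'.1 hQ)

theorem norm_mul_mul_le {A : Matrix ι κ ℂ} {B : Matrix κ ι ℂ} (hA : ‖A‖ ≤ 1) (hB : ‖B‖ ≤ 1)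
    (X : Matrix κ κ ℂ) : ‖A * X * B‖ ≤ ‖X‖ := by
  calc ‖A * X * B‖ ≤ ‖A * X‖ * ‖B‖ := Matrix.l2_opNorm_mul _ _
    _ ≤ (‖A‖ * ‖X‖) * ‖B‖ := by gcongr; exact Matrix.l2_opNorm_mul _ _
    _ ≤ (1 * ‖X‖) * 1 := by gcongr
    _ = ‖X‖ := by ring

theorem norm_submatrix_le {f : ι → κ} (hf : f.Injective) (X : Matrix κ κ ℂ) :
    ‖X.submatrix f f‖ ≤ ‖X‖ := by
  have h := norm_le_one_of_conjTranspose_mul_self (conjTranspose_basisIsometry_mul_self hf)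
  rw [← conjTranspose_basisIsometry_mul_mul]
  exact norm_mul_mul_le (by rwa [Matrix.l2_opNorm_conjTranspose]) h X

theorem norm_apply_self_le (X : Matrix κ κ ℂ) (i : κ) : ‖X i i‖ ≤ ‖X‖ := by
  have h := norm_submatrix_le (f := fun _ : Unit => i) (fun _ _ _ => rfl) X
  have h2 : X.submatrix (fun _ : Unit => i) (fun _ => i) = Matrix.diagonal fun _ => X i i := by
    ext; simp
  rw [h2, Matrix.l2_opNorm_diagonal] at h
  exact (norm_le_pi_norm (fun _ : Unit => X i i) ()).trans h

/-- In an eigenbasis of `ρ` the trace is a sum of diagonal entries of a conjugate of `X`, each of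
modulus at most `‖X‖`, weighted by the nonnegative eigenvalues. -/
theorem norm_trace_mul_le {ρ : Matrix κ κ ℂ} (hρ : ρ.PosSemidef) (X : Matrix κ κ ℂ) :
    ‖(X * ρ).trace‖ ≤ ‖X‖ * ρ.trace.re := by
  obtain ⟨Q, hQ, hd⟩ := exists_unitary_diagonal hρ.isHermitian
  have hp := hρ.eigenvalues_nonneg
  set p := hρ.isHermitian.eigenvalues
  have hQ1 := norm_le_one_of_mem_unitaryGroup hQ
  have hQQ : Qᴴ * Q = 1 := Matrix.mem_unitaryGroup_iff'.1 hQ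
  have htr : ρ.trace.re = ∑ i, p i := by
    rw [hd, Matrix.trace_mul_comm, ← Matrix.mul_assoc, hQQ, Matrix.one_mul, Matrix.trace_diagonal,
      ← Complex.ofReal_sum, Complex.ofReal_re]
  have htx : (X * ρ).trace = ∑ i, (Qᴴ * X * Q) i i * p i := by
    rw [hd, ← Matrix.mul_assoc, Matrix.trace_mul_comm, ← Matrix.mul_assoc, ← Matrix.mul_assoc,
      Matrix.trace]
    simp [Matrix.mul_diagonal]
  rw [htx, htr, Finset.mul_sum]
  refine (norm_sum_le _ _).trans (Finset.sum_le_sum fun i _ => ?_)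
  rw [norm_mul, Complex.norm_real, Real.norm_of_nonneg (hp i)]
  refine mul_le_mul_of_nonneg_right ((norm_apply_self_le _ i).trans ?_) (hp i)
  exact norm_mul_mul_le (by rwa [Matrix.l2_opNorm_conjTranspose]) hQ1 X

theorem roots_charpoly_diagonal (d : κ → ℂ) :
    (Matrix.diagonal d).charpoly.roots = Multiset.map d Finset.univ.val := by
  rw [Matrix.charpoly_diagonal, Polynomial.roots_prod]
  · simp
  · simp [Finset.prod_ne_zero_iff, Polynomial.X_sub_C_ne_zero]

/-- The trace norm of a Hermitian matrix is attained at a unitary matrix. -/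
theorem exists_unitary_traceNorm_eq {M : Matrix κ κ ℂ} (hM : M.IsHermitian) :
    ∃ S ∈ Matrix.unitaryGroup κ ℂ, traceNorm M = (S * M).trace.re := by
  obtain ⟨Q, hQ, hd⟩ := exists_unitary_diagonal hM
  set l := hM.eigenvalues
  have hQQ : Qᴴ * Q = 1 := Matrix.mem_unitaryGroup_iff'.1 hQ
  -- The optimal unitary is the sign of `M`, with sign `1` at eigenvalue `0` to keep it unitary.
  set σ : κ → ℂ := fun i => if 0 ≤ l i then 1 else -1 with hσ
  have hσu : Matrix.diagonal σ ∈ Matrix.unitaryGroup κ ℂ := by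
    rw [Matrix.mem_unitaryGroup_iff, Matrix.star_eq_conjTranspose,
      Matrix.diagonal_conjTranspose, Matrix.diagonal_mul_diagonal, ← Matrix.diagonal_one]
    congr 1
    ext i
    simp only [hσ, Pi.star_apply]
    split_ifs <;> simp
  refine ⟨Q * Matrix.diagonal σ * Qᴴ, mul_mem (mul_mem hQ hσu) (Unitary.star_mem hQ), ?_⟩
  have h1 : (Q * Matrix.diagonal σ * Qᴴ * M).trace.re = ∑ i, |l i| := by
    have : (Q * Matrix.diagonal σ * Qᴴ * M).trace = ∑ i, σ i * l i := by
      rw [hd, show Q * Matrix.diagonal σ * Qᴴ * (Q * Matrix.diagonal (fun i => (l i : ℂ)) * Qᴴ) =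
        Q * (Matrix.diagonal σ * (Qᴴ * Q) * Matrix.diagonal (fun i => (l i : ℂ)) * Qᴴ) by
          simp only [Matrix.mul_assoc], Matrix.trace_mul_comm, hQQ, Matrix.mul_one,
        Matrix.mul_assoc, hQQ, Matrix.mul_one, Matrix.diagonal_mul_diagonal,
        Matrix.trace_diagonal]
    rw [this, Complex.re_sum]
    refine Finset.sum_congr rfl fun i _ => ?_
    simp only [hσ]
    split_ifs with h
    · simp [abs_of_nonneg h]
    · simp [abs_of_neg (not_le.1 h)]
  rw [h1, traceNorm]
  have hN := Matrix.isHermitian_conjTranspose_mul_self M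
  have hMM : Mᴴ * M = Q * Matrix.diagonal (fun i => ((l i ^ 2 : ℝ) : ℂ)) * Qᴴ := by
    rw [hM.eq]
    nth_rewrite 1 2 [hd]
    rw [show Q * Matrix.diagonal (fun i => (l i : ℂ)) * Qᴴ *
      (Q * Matrix.diagonal (fun i => (l i : ℂ)) * Qᴴ) =
        Q * (Matrix.diagonal (fun i => (l i : ℂ)) * (Qᴴ * Q) *
          Matrix.diagonal (fun i => (l i : ℂ))) * Qᴴ by simp only [Matrix.mul_assoc], hQQ,
      Matrix.mul_one, Matrix.diagonal_mul_diagonal]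
    simp only [pow_two, Complex.ofReal_mul]
  -- The eigenvalues of `Mᴴ * M` carry their own enumeration, so they are matched with the squares
  -- `l i ^ 2` as multisets of roots.
  have hroots : (Mᴴ * M).charpoly.roots =
      Multiset.map (fun i => ((l i ^ 2 : ℝ) : ℂ)) Finset.univ.val := by
    rw [hMM, Matrix.charpoly_mul_comm, ← Matrix.mul_assoc, hQQ, Matrix.one_mul,
      roots_charpoly_diagonal]
  rw [hN.roots_charpoly_eq_eigenvalues] at hroots
  have h2 := congrArg (fun s => (Multiset.map (fun z : ℂ => Real.sqrt z.re) s).sum) hroots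
  simp only [Multiset.map_map, Function.comp_def] at h2
  have h3 : ∀ i, Real.sqrt ((l i ^ 2 : ℝ) : ℂ).re = |l i| := fun i => by
    rw [Complex.ofReal_re, Real.sqrt_sq_eq_abs]
  simp only [h3] at h2
  exact h2

end Norms

end HamSim

namespace HamSim

variable {ι : Type*} [Fintype ι] [DecidableEq ι]

/-! ### Ampliations -/

section Ampliate

variable {κ : Type*} [Fintype κ] [DecidableEq κ]

theorem ampliate_sub (Φ Ψ : Matrix ι ι ℂ →ₗ[ℂ] Matrix ι ι ℂ)
    (X : Matrix (ι × κ) (ι × κ) ℂ) : ampliate (Φ - Ψ) X = ampliate Φ X - ampliate Ψ X := by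
  ext p q
  simp [ampliate]

theorem ampliate_sum {α : Type*} (s : Finset α) (Φ : α → Matrix ι ι ℂ →ₗ[ℂ] Matrix ι ι ℂ)
    (X : Matrix (ι × κ) (ι × κ) ℂ) : ampliate (∑ x ∈ s, Φ x) X = ∑ x ∈ s, ampliate (Φ x) X := by
  ext p q
  simp [ampliate, Matrix.sum_apply]

theorem ampliate_conjMap (K : Matrix ι ι ℂ) (X : Matrix (ι × κ) (ι × κ) ℂ) :
    ampliate (conjMap K) X =
      (K ⊗ₖ (1 : Matrix κ κ ℂ)) * X * (K ⊗ₖ (1 : Matrix κ κ ℂ))ᴴ := by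
  ext ⟨i, a⟩ ⟨j, b⟩
  rw [Matrix.mul_assoc]
  simp [ampliate, conjMap, Matrix.mul_apply, Fintype.sum_prod_type, Matrix.one_apply,
    Matrix.conjTranspose_apply, apply_ite star, -RCLike.star_def]

theorem conjTranspose_kronecker_one_mul (K L : Matrix ι ι ℂ) :
    (K ⊗ₖ (1 : Matrix κ κ ℂ))ᴴ * (L ⊗ₖ (1 : Matrix κ κ ℂ)) = (Kᴴ * L) ⊗ₖ (1 : Matrix κ κ ℂ) := by
  rw [Matrix.conjTranspose_kronecker, Matrix.conjTranspose_one, ← Matrix.mul_kronecker_mul,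
    Matrix.one_mul]

theorem sum_conjTranspose_kronecker_one_mul {α : Type*} [Fintype α] {K : α → Matrix ι ι ℂ}
    (hK : ∑ x, (K x)ᴴ * K x = 1) :
    ∑ x, (K x ⊗ₖ (1 : Matrix κ κ ℂ))ᴴ * (K x ⊗ₖ (1 : Matrix κ κ ℂ)) = 1 := by
  simp only [conjTranspose_kronecker_one_mul]
  have : ∑ x, ((K x)ᴴ * K x) ⊗ₖ (1 : Matrix κ κ ℂ) =
      (∑ x, (K x)ᴴ * K x) ⊗ₖ (1 : Matrix κ κ ℂ) := by
    ext p q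
    simp [Matrix.sum_apply, Finset.sum_mul]
  rw [this, hK, Matrix.one_kronecker_one]

open scoped Matrix.Norms.L2Operator in
-- Tensoring with the identity is a star homomorphism of C⋆-algebras, hence contractive.
theorem norm_kronecker_one_le (A : Matrix ι ι ℂ) : ‖A ⊗ₖ (1 : Matrix κ κ ℂ)‖ ≤ ‖A‖ := by
  let φ : Matrix ι ι ℂ →⋆ₐ[ℂ] Matrix (ι × κ) (ι × κ) ℂ :=
    { toFun := fun A => A ⊗ₖ (1 : Matrix κ κ ℂ)
      map_one' := Matrix.one_kronecker_one
      map_mul' := fun A B => by rw [← Matrix.mul_kronecker_mul, Matrix.one_mul]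
      map_zero' := Matrix.zero_kronecker _
      map_add' := fun A B => Matrix.add_kronecker _ _ _
      commutes' := fun r => by
        rw [Algebra.algebraMap_eq_smul_one, Algebra.algebraMap_eq_smul_one,
          Matrix.smul_kronecker, Matrix.one_kronecker_one]
      map_star' := fun A => by
        simp only [Matrix.star_eq_conjTranspose]
        rw [Matrix.conjTranspose_kronecker, Matrix.conjTranspose_one] }
  exact NonUnitalStarAlgHom.norm_apply_le φ A

end Ampliate

/-! ### Maps in Kraus form -/

section Kraus

variable {α : Type*} [Fintype α] {K : α → Matrix ι ι ℂ}

theorem isChannel_sum_conjMap (hK : ∑ x, (K x)ᴴ * K x = 1) :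
    IsChannel (∑ x, conjMap (K x)) := by
  refine ⟨fun k X hX => ?_, fun X => ?_⟩
  · rw [ampliate_sum]
    refine Matrix.posSemidef_sum _ fun x _ => ?_
    rw [ampliate_conjMap]
    exact hX.mul_mul_conjTranspose_same _
  · rw [LinearMap.sum_apply, Matrix.trace_sum]
    have : ∀ x, (conjMap (K x) X).trace = ((K x)ᴴ * K x * X).trace := fun x => by
      change (K x * (X * (K x)ᴴ)).trace = _
      rw [← Matrix.mul_assoc, Matrix.trace_mul_comm, Matrix.mul_assoc]
    simp only [this]
    rw [← Matrix.trace_sum, ← Finset.sum_mul, hK, one_mul]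

open scoped Matrix.Norms.L2Operator in
theorem abs_re_trace_unitary_mul_le {κ : Type*} [Fintype κ] [DecidableEq κ] {S P : Matrix κ κ ℂ}
    (hS : S ∈ Matrix.unitaryGroup κ ℂ) (hP : P.PosSemidef) :
    |(S * P).trace.re| ≤ P.trace.re := by
  have h0 : 0 ≤ P.trace.re := (Complex.le_def.1 hP.trace_nonneg).1
  refine (Complex.abs_re_le_norm _).trans ((norm_trace_mul_le hP S).trans ?_)
  exact mul_le_of_le_one_left h0 (norm_le_one_of_mem_unitaryGroup hS)

theorem trace_sum_conj {κ : Type*} [Fintype κ] [DecidableEq κ] {L : α → Matrix κ κ ℂ}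
    (hL : ∑ x, (L x)ᴴ * L x = 1) (ρ : Matrix κ κ ℂ) :
    (∑ x, L x * ρ * (L x)ᴴ).trace = ρ.trace := by
  rw [Matrix.trace_sum]
  have : ∀ x, (L x * ρ * (L x)ᴴ).trace = ((L x)ᴴ * L x * ρ).trace := fun x => by
    rw [Matrix.trace_mul_comm, Matrix.mul_assoc]
  simp only [this]
  rw [← Matrix.trace_sum, ← Finset.sum_mul, hL, one_mul]

/-- The distance of two channels is at most `2`. -/
theorem diamondNorm_sub_le_two (hK : ∑ x, (K x)ᴴ * K x = 1) {V : Matrix ι ι ℂ} (hV : Vᴴ * V = 1) :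
    diamondNorm (∑ x, conjMap (K x) - conjMap V) ≤ ENNReal.ofReal 2 := by
  refine iSup_le fun k => iSup_le fun ρ => iSup_le fun hρ => ENNReal.ofReal_le_ofReal ?_
  rw [ampliate_sub, ampliate_sum]
  simp only [ampliate_conjMap]
  have hL := sum_conjTranspose_kronecker_one_mul (κ := Fin k) hK
  have hT := conjTranspose_kronecker_one_mul (κ := Fin k) V V
  rw [hV, Matrix.one_kronecker_one] at hT
  set L : α → Matrix (ι × Fin k) (ι × Fin k) ℂ := fun x => K x ⊗ₖ (1 : Matrix (Fin k) (Fin k) ℂ)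
  set T := V ⊗ₖ (1 : Matrix (Fin k) (Fin k) ℂ)
  have hP : (∑ x, L x * ρ * (L x)ᴴ).PosSemidef :=
    Matrix.posSemidef_sum _ fun x _ => hρ.1.mul_mul_conjTranspose_same _
  have hP' : (T * ρ * Tᴴ).PosSemidef := hρ.1.mul_mul_conjTranspose_same _
  obtain ⟨S, hS, h⟩ := exists_unitary_traceNorm_eq (hP.isHermitian.sub hP'.isHermitian)
  rw [h, Matrix.mul_sub, Matrix.trace_sub, Complex.sub_re]
  have h1 := abs_le.1 (abs_re_trace_unitary_mul_le hS hP)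
  have h2 := abs_le.1 (abs_re_trace_unitary_mul_le hS hP')
  rw [trace_sum_conj hL, hρ.2, Complex.one_re] at h1
  rw [Matrix.trace_mul_comm, ← Matrix.mul_assoc, hT, Matrix.one_mul, hρ.2, Complex.one_re] at h2
  linarith [h1.2, h2.1]

open scoped Matrix.Norms.L2Operator in
/-- A channel with a Kraus operator close to a unitary matrix is close to the unitary channel. -/
theorem diamondNorm_sub_le [DecidableEq α] (hK : ∑ x, (K x)ᴴ * K x = 1) {V : Matrix ι ι ℂ}
    (hV : Vᴴ * V = 1) {x₀ : α} {δ : ℝ} (h1 : ‖K x₀‖ ≤ 1) (hδ : ‖K x₀ - V‖ ≤ δ) :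
    diamondNorm (∑ x, conjMap (K x) - conjMap V) ≤ ENNReal.ofReal (4 * δ) := by
  refine iSup_le fun k => iSup_le fun ρ => iSup_le fun hρ => ENNReal.ofReal_le_ofReal ?_
  rw [ampliate_sub, ampliate_sum]
  simp only [ampliate_conjMap]
  have hL := sum_conjTranspose_kronecker_one_mul (κ := Fin k) hK
  have hT := conjTranspose_kronecker_one_mul (κ := Fin k) V V
  rw [hV, Matrix.one_kronecker_one] at hT
  have hL1 := (norm_kronecker_one_le (κ := Fin k) (K x₀)).trans h1
  have hLT := (norm_kronecker_one_le (κ := Fin k) (K x₀ - V)).trans hδ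
  rw [sub_eq_add_neg, Matrix.add_kronecker, ← neg_one_smul ℂ V, Matrix.smul_kronecker,
    neg_one_smul, ← sub_eq_add_neg] at hLT
  set L : α → Matrix (ι × Fin k) (ι × Fin k) ℂ := fun x => K x ⊗ₖ (1 : Matrix (Fin k) (Fin k) ℂ)
    with hLdef
  change ‖L x₀‖ ≤ 1 at hL1
  set T := V ⊗ₖ (1 : Matrix (Fin k) (Fin k) ℂ)
  change ‖L x₀ - T‖ ≤ δ at hLT
  have hT1 : ‖T‖ ≤ 1 := norm_le_one_of_conjTranspose_mul_self hT
  set P := ∑ x ∈ Finset.univ.erase x₀, L x * ρ * (L x)ᴴ with hPdef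
  have hsplit : ∑ x, L x * ρ * (L x)ᴴ = L x₀ * ρ * (L x₀)ᴴ + P :=
    (Finset.add_sum_erase _ _ (Finset.mem_univ x₀)).symm
  have hP : P.PosSemidef := Matrix.posSemidef_sum _ fun x _ => hρ.1.mul_mul_conjTranspose_same _
  have hA : (L x₀ * ρ * (L x₀)ᴴ).PosSemidef := hρ.1.mul_mul_conjTranspose_same _
  have hB : (T * ρ * Tᴴ).PosSemidef := hρ.1.mul_mul_conjTranspose_same _
  -- The contribution of the distinguished Kraus operator: telescoping `L† S L - T† S T` costs one
  -- factor `‖L - T‖` on each side.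
  have key : ∀ S ∈ Matrix.unitaryGroup (ι × Fin k) ℂ,
      |(S * (L x₀ * ρ * (L x₀)ᴴ - T * ρ * Tᴴ)).trace.re| ≤ 2 * δ := by
    intro S hS
    have hS1 := norm_le_one_of_mem_unitaryGroup hS
    have e : (S * (L x₀ * ρ * (L x₀)ᴴ - T * ρ * Tᴴ)).trace =
        (((L x₀)ᴴ * S * L x₀ - Tᴴ * S * T) * ρ).trace := by
      have e1 : ∀ Z : Matrix (ι × Fin k) (ι × Fin k) ℂ,
          (S * (Z * ρ * Zᴴ)).trace = (Zᴴ * S * Z * ρ).trace := fun Z => by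
        rw [← Matrix.mul_assoc, Matrix.trace_mul_comm]
        simp only [Matrix.mul_assoc]
      rw [Matrix.mul_sub, Matrix.sub_mul, Matrix.trace_sub, Matrix.trace_sub, e1, e1]
    rw [e]
    refine (Complex.abs_re_le_norm _).trans ((norm_trace_mul_le hρ.1 _).trans ?_)
    rw [hρ.2, Complex.one_re, mul_one]
    have e2 : (L x₀)ᴴ * S * L x₀ - Tᴴ * S * T =
        (L x₀ - T)ᴴ * (S * L x₀) + Tᴴ * S * (L x₀ - T) := by
      rw [Matrix.conjTranspose_sub, Matrix.sub_mul, Matrix.mul_sub]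
      simp only [Matrix.mul_assoc]
      abel
    rw [e2]
    have hδ0 : 0 ≤ δ := (norm_nonneg _).trans hLT
    have b1 : ‖(L x₀ - T)ᴴ * (S * L x₀)‖ ≤ δ * (1 * 1) := by
      refine (norm_mul_le _ _).trans ?_
      rw [Matrix.l2_opNorm_conjTranspose]
      have := (norm_mul_le S (L x₀)).trans (mul_le_mul hS1 hL1 (norm_nonneg _) zero_le_one)
      gcongr
    have b2 : ‖Tᴴ * S * (L x₀ - T)‖ ≤ 1 * 1 * δ := by
      refine (norm_mul_le _ _).trans ?_
      have := norm_mul_le Tᴴ S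
      rw [Matrix.l2_opNorm_conjTranspose] at this
      have := this.trans (mul_le_mul hT1 hS1 (norm_nonneg _) zero_le_one)
      gcongr
    refine (norm_add_le _ _).trans ?_
    linarith
  -- The remaining Kraus operators carry exactly the trace that the distinguished one loses, which
  -- is bounded by the case `S = 1`.
  have htr : P.trace.re ≤ 2 * δ := by
    have h := trace_sum_conj hL ρ
    rw [hsplit, Matrix.trace_add] at h
    have h2 := key 1 (one_mem _)
    rw [Matrix.one_mul, Matrix.trace_sub, Matrix.trace_mul_comm (T * ρ), ← Matrix.mul_assoc, hT,
      Matrix.one_mul, ← h, sub_add_cancel_left, Complex.neg_re, abs_neg] at h2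
    exact (le_abs_self _).trans h2
  rw [hsplit]
  obtain ⟨S, hS, h⟩ := exists_unitary_traceNorm_eq
    ((hA.isHermitian.add hP.isHermitian).sub hB.isHermitian)
  rw [h, add_sub_right_comm, Matrix.mul_add, Matrix.trace_add, Complex.add_re]
  linarith [(abs_le.1 (key S hS)).2, (abs_le.1 (abs_re_trace_unitary_mul_le hS hP)).2]

end Kraus

end HamSim

namespace HamSim

open Polynomial

variable {ι : Type*} [Fintype ι] [DecidableEq ι] {w m : ℕ}

/-! ### The channel of a circuit -/

/-- This is the orthonormality of the columns of `W` that belong to the initial state of the qubits.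
-/
theorem sum_conjTranspose_mul_kraus {W : Matrix (Register w m ι) (Register w m ι) ℂ}
    (hW : W ∈ Matrix.unitaryGroup (Register w m ι) ℂ) :
    ∑ x : Fin 2 × Qubits w × Qubits m,
      (Matrix.of fun i j : ι => W (x.1, x.2.1, x.2.2, i) (0, 0, 0, j))ᴴ *
        (Matrix.of fun i j : ι => W (x.1, x.2.1, x.2.2, i) (0, 0, 0, j)) = 1 := by
  have h := Matrix.mem_unitaryGroup_iff'.1 hW
  ext i j
  have hij := congrFun (congrFun h (0, 0, 0, i)) (0, 0, 0, j)
  simp only [Matrix.mul_apply, Matrix.star_apply, Fintype.sum_prod_type] at hij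
  simp only [Matrix.sum_apply, Matrix.mul_apply, Matrix.conjTranspose_apply, Matrix.of_apply,
    Fintype.sum_prod_type, hij]
  simp [Matrix.one_apply]

/-! ### Functions of Hermitian matrices -/

theorem aeval_conj_diagonal {Q : Matrix ι ι ℂ} (hQ : Q ∈ Matrix.unitaryGroup ι ℂ) (d : ι → ℂ)
    (p : ℂ[X]) : aeval (Q * Matrix.diagonal d * Qᴴ) p =
      Q * Matrix.diagonal (fun i => p.eval (d i)) * Qᴴ := by
  have hQQ : Qᴴ * Q = 1 := Matrix.mem_unitaryGroup_iff'.1 hQ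
  have hQQ' : Q * Qᴴ = 1 := Matrix.mem_unitaryGroup_iff.1 hQ
  induction p using Polynomial.induction_on' with
  | add p q hp hq =>
    rw [map_add, hp, hq, ← Matrix.add_mul, ← Matrix.mul_add, Matrix.diagonal_add]
    simp
  | monomial n a =>
    have hpow : (Q * Matrix.diagonal d * Qᴴ) ^ n = Q * Matrix.diagonal (fun i => d i ^ n) * Qᴴ := by
      induction n with
      | zero => simp [hQQ']
      | succ n ih =>
        rw [pow_succ, ih, show Q * Matrix.diagonal (fun i => d i ^ n) * Qᴴ *
          (Q * Matrix.diagonal d * Qᴴ) = Q * (Matrix.diagonal (fun i => d i ^ n) * (Qᴴ * Q) *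
            Matrix.diagonal d) * Qᴴ by simp only [Matrix.mul_assoc], hQQ, Matrix.mul_one,
          Matrix.diagonal_mul_diagonal]
        simp only [pow_succ]
    rw [aeval_monomial, hpow, Algebra.algebraMap_eq_smul_one, smul_mul_assoc, one_mul,
      ← Matrix.smul_mul, ← Matrix.mul_smul, ← Matrix.diagonal_smul]
    simp [Pi.smul_def]

theorem exp_conj_diagonal {Q : Matrix ι ι ℂ} (hQ : Q ∈ Matrix.unitaryGroup ι ℂ) (d : ι → ℂ)
    (c : ℂ) : NormedSpace.exp (c • (Q * Matrix.diagonal d * Qᴴ)) =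
      Q * Matrix.diagonal (fun i => Complex.exp (c * d i)) * Qᴴ := by
  have hQQ' : Q * Qᴴ = 1 := Matrix.mem_unitaryGroup_iff.1 hQ
  have hQQ : Qᴴ * Q = 1 := Matrix.mem_unitaryGroup_iff'.1 hQ
  have hinv : Q⁻¹ = Qᴴ := Matrix.inv_eq_right_inv hQQ'
  rw [← Matrix.smul_mul, ← Matrix.mul_smul, ← Matrix.diagonal_smul, ← hinv,
    Matrix.exp_conj _ _ ⟨⟨Q, Qᴴ, hQQ', hQQ⟩, rfl⟩, Matrix.exp_diagonal]
  congr 3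
  ext i
  simp [Pi.coe_exp, Complex.exp_eq_exp_ℂ]

/-- Amplification of a multiple `u / 2` of an approximate phase. -/
theorem norm_amplified_sub_le {u v : ℂ} {η : ℝ} (hv : ‖v‖ = 1) (h : ‖u - v‖ ≤ η) (hη : η ≤ 1 / 4) :
    ‖(3 / 2 * u - 1 / 2 * (u * star u * u)) - v‖ ≤ 2 * η := by
  obtain ⟨e, rfl⟩ : ∃ e, u = v + e := ⟨u - v, by ring⟩
  rw [add_sub_cancel_left] at h
  have hvv : v * star v = 1 := by
    have : v * star v = (‖v‖ ^ 2 : ℂ) := Complex.mul_conj' v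
    rw [this, hv]; norm_num
  have hs : ‖star e‖ = ‖e‖ := norm_star e
  have hsv : ‖star v‖ = 1 := by rw [norm_star, hv]
  -- The first-order term is `(e - v² conj e) / 2`, of norm at most `‖e‖`. For `‖e‖ ≤ 1 / 4` the
  -- higher-order terms add at most `‖e‖ / 2`.
  have heq : (3 / 2 * (v + e) - 1 / 2 * ((v + e) * star (v + e) * (v + e))) - v =
      (1 / 2) * (e - v * v * star e - 2 * v * e * star e - e * e * star v - e * e * star e) := by
    rw [star_add]
    linear_combination (-(1 / 2) * v - e) * hvv
  have h0 := norm_nonneg e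
  have b : ‖e - v * v * star e - 2 * v * e * star e - e * e * star v - e * e * star e‖ ≤
      ‖e‖ + ‖e‖ + 2 * ‖e‖ * ‖e‖ + ‖e‖ * ‖e‖ + ‖e‖ * ‖e‖ * ‖e‖ := by
    refine (norm_sub_le _ _).trans (add_le_add ((norm_sub_le _ _).trans (add_le_add
      ((norm_sub_le _ _).trans (add_le_add ((norm_sub_le _ _).trans (add_le_add le_rfl ?_)) ?_))
        ?_)) ?_) <;> simp only [norm_mul, hs, hv, hsv] <;> norm_num
  have b2 : ‖e‖ * ‖e‖ ≤ 1 / 4 * ‖e‖ := by nlinarith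
  have b3 : ‖e‖ * ‖e‖ * ‖e‖ ≤ 1 / 4 * ‖e‖ := by nlinarith
  rw [heq, norm_mul, show ‖(1 / 2 : ℂ)‖ = 1 / 2 by norm_num]
  linarith

open scoped Matrix.Norms.L2Operator in
-- All matrices involved are diagonal in an eigenbasis of `H`, whose eigenvalues lie in `[-1, 1]`,
-- so the scalar estimate applies entrywise.
theorem norm_amplified_polynomial_sub_exp_le {H : Matrix ι ι ℂ} (hH : H.IsHermitian)
    (hH1 : ‖H‖ ≤ 1) {p : ℂ[X]} {t η : ℝ} (hη : η ≤ 1 / 4)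
    (hp : ∀ x : ℝ, |x| ≤ 1 → ‖p.eval (x : ℂ) - Complex.exp (Complex.I * t * x)‖ ≤ η) :
    ‖(3 : ℂ) • ((1 / 2 : ℂ) • aeval H p) - (4 : ℂ) • (((1 / 2 : ℂ) • aeval H p) *
      ((1 / 2 : ℂ) • aeval H p)ᴴ * ((1 / 2 : ℂ) • aeval H p)) -
        NormedSpace.exp ((Complex.I * (t : ℂ)) • H)‖ ≤ 2 * η := by
  obtain ⟨Q, hQ, hd⟩ := exists_unitary_diagonal hH
  set l := hH.eigenvalues
  have hQQ : Qᴴ * Q = 1 := Matrix.mem_unitaryGroup_iff'.1 hQ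
  have hQ1 := norm_le_one_of_mem_unitaryGroup hQ
  have hQ1' : ‖Qᴴ‖ ≤ 1 := by rwa [Matrix.l2_opNorm_conjTranspose]
  have hl : ∀ i, |l i| ≤ 1 := by
    intro i
    have h1 : Qᴴ * H * Q = Matrix.diagonal fun i => (l i : ℂ) := by
      rw [hd, show Qᴴ * (Q * Matrix.diagonal (fun i => (l i : ℂ)) * Qᴴ) * Q =
        (Qᴴ * Q) * Matrix.diagonal (fun i => (l i : ℂ)) * (Qᴴ * Q) by
          simp only [Matrix.mul_assoc], hQQ, Matrix.one_mul, Matrix.mul_one]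
    have h2 := (norm_apply_self_le (Qᴴ * H * Q) i).trans
      ((norm_mul_mul_le hQ1' hQ1 H).trans hH1)
    rwa [h1, Matrix.diagonal_apply_eq, Complex.norm_real] at h2
  have hη0 : ∀ i : ι, 0 ≤ η := fun i => (norm_nonneg _).trans (hp _ (hl i))
  have hexp : NormedSpace.exp ((Complex.I * (t : ℂ)) • H) =
      Q * Matrix.diagonal (fun i => Complex.exp (Complex.I * t * l i)) * Qᴴ := by
    conv_lhs => rw [hd]
    exact exp_conj_diagonal hQ _ _
  have haev : aeval H p = Q * Matrix.diagonal (fun i => p.eval (l i : ℂ)) * Qᴴ := by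
    conv_lhs => rw [hd]
    exact aeval_conj_diagonal hQ _ _
  set u : ι → ℂ := fun i => p.eval (l i : ℂ) with hu
  have hsmul : ∀ (c : ℂ) (d : ι → ℂ), c • (Q * Matrix.diagonal d * Qᴴ) =
      Q * Matrix.diagonal (c • d) * Qᴴ := fun c d => by
    rw [Matrix.diagonal_smul, Matrix.mul_smul, Matrix.smul_mul]
  have hB : (1 / 2 : ℂ) • aeval H p = Q * Matrix.diagonal ((1 / 2 : ℂ) • u) * Qᴴ := by
    rw [haev, hsmul]
  have hall : (3 : ℂ) • ((1 / 2 : ℂ) • aeval H p) - (4 : ℂ) • (((1 / 2 : ℂ) • aeval H p) *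
      ((1 / 2 : ℂ) • aeval H p)ᴴ * ((1 / 2 : ℂ) • aeval H p)) -
        NormedSpace.exp ((Complex.I * (t : ℂ)) • H) =
      Q * Matrix.diagonal (fun i => (3 / 2 * u i - 1 / 2 * (u i * star (u i) * u i)) -
        Complex.exp (Complex.I * t * l i)) * Qᴴ := by
    have hBBB : ∀ d : ι → ℂ, (Q * Matrix.diagonal d * Qᴴ) * (Q * Matrix.diagonal d * Qᴴ)ᴴ *
        (Q * Matrix.diagonal d * Qᴴ) =
          Q * Matrix.diagonal (fun i => d i * star (d i) * d i) * Qᴴ := by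
      intro d
      rw [Matrix.conjTranspose_mul, Matrix.conjTranspose_mul, Matrix.conjTranspose_conjTranspose,
        Matrix.diagonal_conjTranspose,
        show Q * Matrix.diagonal d * Qᴴ * (Q * (Matrix.diagonal (star d) * Qᴴ)) *
          (Q * Matrix.diagonal d * Qᴴ) = Q * (Matrix.diagonal d * (Qᴴ * Q) *
            Matrix.diagonal (star d) * (Qᴴ * Q) * Matrix.diagonal d) * Qᴴ by
          simp only [Matrix.mul_assoc], hQQ, Matrix.mul_one, Matrix.mul_one,
        Matrix.diagonal_mul_diagonal, Matrix.diagonal_mul_diagonal]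
      rfl
    rw [hB, hBBB, hexp, hsmul, hsmul, ← Matrix.sub_mul,
      ← Matrix.sub_mul, ← Matrix.mul_sub, ← Matrix.mul_sub, Matrix.diagonal_sub,
      Matrix.diagonal_sub]
    congr 4
    ext i
    simp
    ring
  rw [hall]
  refine (norm_mul_mul_le hQ1 hQ1' _).trans ?_
  rw [Matrix.l2_opNorm_diagonal]
  cases isEmpty_or_nonempty ι with
  | inl h =>
    -- With no eigenvalue at hand, `0 ≤ η` is read off from the hypothesis at `x = 0`.
    have h0 := hp 0 (by simp)
    rw [pi_norm_le_iff_of_nonneg (by linarith [(norm_nonneg _).trans h0])]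
    exact fun i => (h.false i).elim
  | inr h =>
    rw [pi_norm_le_iff_of_nonneg (by linarith [hη0 h.some])]
    intro i
    refine norm_amplified_sub_le ?_ (hp _ (hl i)) hη
    rw [show Complex.I * t * l i = ((t * l i : ℝ) : ℂ) * Complex.I by push_cast; ring,
      Complex.norm_exp_ofReal_mul_I]

theorem conjTranspose_exp_mul_exp {H : Matrix ι ι ℂ} (hH : H.IsHermitian) (t : ℝ) :
    (NormedSpace.exp ((Complex.I * (t : ℂ)) • H))ᴴ *
      NormedSpace.exp ((Complex.I * (t : ℂ)) • H) = 1 := by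
  rw [← Matrix.exp_conjTranspose, Matrix.conjTranspose_smul, hH.eq]
  have : star (Complex.I * (t : ℂ)) = -(Complex.I * (t : ℂ)) := by simp
  rw [this, neg_smul, Matrix.exp_neg, Matrix.nonsing_inv_mul]
  exact (Matrix.isUnit_iff_isUnit_det _).1 (Matrix.isUnit_exp _)

theorem rate_pos {t' ε' : ℝ} (ht : 0 < t') (h0 : 0 < ε') : 0 < rate t' ε' := by
  by_cases h1 : ε' < 1
  · exact ht.trans (rate_spec ht h0 h1).1
  · rw [rate, dif_neg fun h => h1 h.2.2]
    exact ht

end HamSim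

/-! ### Choice of parameters and the error budget -/

theorem mainTheorem9 {ι : Type*} [Fintype ι] [DecidableEq ι] (m : ℕ)
    (t ε : ℝ) (ht : 0 < t) (hε : 0 < ε) :
    ∃ (w : ℕ) (C : HamSim.Circuit w m ι),
      (HamSim.Circuit.queries C : ℝ) ≤ 3 * HamSim.rate (Real.exp 1 * t / 2) (ε / 24) + 3 ∧
      ∀ (H : Matrix ι ι ℂ) (U : Matrix (HamSim.Qubits m × ι) (HamSim.Qubits m × ι) ℂ),
        H.IsHermitian → HamSim.IsBlockEncoding U H →
          HamSim.IsChannel (HamSim.Circuit.channel C U) ∧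
          HamSim.diamondNorm (HamSim.Circuit.channel C U -
              HamSim.conjMap (NormedSpace.exp ((Complex.I * (t : ℂ)) • H))) ≤
            ENNReal.ofReal ε := by
  have hr : 0 < HamSim.rate (Real.exp 1 * t / 2) (ε / 24) :=
    HamSim.rate_pos (by positivity) (by positivity)
  -- For `ε ≥ 2` the empty circuit suffices. Below `2`, the approximation error `ε / 8` meets the
  -- threshold `1 / 4` of the amplification step, and `ε / 24 < 1`.
  rcases le_or_gt 2 ε with h2 | h2
  · refine ⟨0, [], ?_, fun H U hH hU => ?_⟩
    · simp only [HamSim.Circuit.queries, List.map_nil, List.sum_nil, Nat.cast_zero]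
      positivity
    · have hK := HamSim.sum_conjTranspose_mul_kraus
        (HamSim.Circuit.eval_mem_unitaryGroup hU.unitary ([] : HamSim.Circuit 0 m ι))
      exact ⟨HamSim.isChannel_sum_conjMap hK, (HamSim.diamondNorm_sub_le_two hK
        (HamSim.conjTranspose_exp_mul_exp hH t)).trans (ENNReal.ofReal_le_ofReal h2)⟩
  · set r := HamSim.rate (Real.exp 1 * t / 2) (ε / 24)
    set n := ⌊r⌋₊
    have hn : r ≤ (n + 1 : ℕ) := by push_cast; exact (Nat.lt_floor_add_one r).le
    obtain ⟨F, hF, hFsum⟩ := HamSim.exists_polynomials_near_exp ht hε (by linarith) hn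
    obtain ⟨hd1, hp1, hb1⟩ := hF (n + 1)
    obtain ⟨hd2, hp2, hb2⟩ := hF (n + 1 + 1)
    -- The polynomial whose parity differs from that of `n + 1` has no term of degree `n + 1`. It
    -- therefore fits the shorter branch, and `n + 1` queries suffice for both.
    have hd2' : (F (n + 1 + 1)).natDegree ≤ n := by
      rw [Polynomial.natDegree_le_iff_coeff_eq_zero]
      intro k hk
      rcases (show n + 1 ≤ k from hk).eq_or_lt with rfl | hlt
      · exact hp2 _ (by omega)
      · exact Polynomial.coeff_eq_zero_of_natDegree_lt (hd2.trans_lt hlt)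
    obtain ⟨C, hC, hCB⟩ := HamSim.exists_circuit_block (m := m) (ι := ι) hd1 hp1 hb1 hd2'
      (fun k hk => hp2 k (by omega)) hb2
    obtain ⟨D, hD, hDB⟩ := HamSim.exists_circuit_amplified C
    refine ⟨2, D, ?_, fun H U hH hU => ?_⟩
    · rw [hD, hC]
      have := Nat.floor_le hr.le
      push_cast
      linarith
    · have hW := HamSim.Circuit.eval_mem_unitaryGroup hU.unitary D
      have hK := HamSim.sum_conjTranspose_mul_kraus hW
      refine ⟨HamSim.isChannel_sum_conjMap hK, ?_⟩
      have hblock := hDB U hU.unitary _ (hCB H U hH hU)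
      rw [← map_add] at hblock
      open scoped Matrix.Norms.L2Operator in
      have hH1 : ‖H‖ ≤ 1 := by
        have hinj : (fun i : ι => ((0 : HamSim.Qubits m), i)).Injective :=
          fun i j h => by simpa using h
        rw [← hU.submatrix_eq]
        exact (HamSim.norm_submatrix_le hinj U).trans
          (HamSim.norm_le_one_of_mem_unitaryGroup hU.unitary)
      have hnear := HamSim.norm_amplified_polynomial_sub_exp_le hH hH1 (η := ε / 8)
        (by linarith) (p := F (n + 1) + F (n + 1 + 1)) (t := t) fun x hx => by
          rw [Polynomial.eval_add]; exact hFsum (n + 1) x hx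
      rw [← hblock] at hnear
      have hnorm := (HamSim.norm_submatrix_le (HamSim.systemEmbedding_injective) _).trans
        (HamSim.norm_le_one_of_mem_unitaryGroup hW)
      -- The distinguished Kraus operator is the one for the outcome in which all qubits return to
      -- `0`: the amplified block. Its error is `2 * (ε / 8)`, and the channel bound multiplies it
      -- by `4`.
      have := HamSim.diamondNorm_sub_le hK (HamSim.conjTranspose_exp_mul_exp hH t)
        (x₀ := (0, 0, 0)) hnorm hnear
      refine this.trans (ENNReal.ofReal_le_ofReal ?_)
      linarith
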